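/- For an integer $n\ge 1$ let $\Vert n\Vert$ denote its complexity, i.e. the least number of $1$'s needed to write $n$ using only $1$, $+$, $\times$ and parentheses. Let $E$ be the function computed by the following procedure (all quotients of integers are rounded down): $E(0)=1$, and for $n\ge1$: set $r:=1$; while $n>4$ replace $r$ by $3r$ and $n$ by $n-3$; return $r\cdot n$. Consider the following algorithm with input an integer $N\ge 1$, which fills an array $\mathrm{Compl}[0..N]$. 1. Set $\mathrm{cMax}:=\lfloor 3\log N/\log 2\rfloor+1$, set all $\mathrm{Compl}[0],\dots,\mathrm{Compl}[N]$ to $\mathrm{cMax}$, then set $\mathrm{Compl}[1]:=1$. 2. For $n=2,3,\dots,N$ in this order: - (usual best value) if $\mathrm{Compl}[n-1]+1<\mathrm{Compl}[n]$, set $\mathrm{Compl}[n]:=\mathrm{Compl}[n-1]+1$; - (computing kMax) set $T:=\mathrm{Compl}[n-1]$ and $t:=\lfloor T/2\rfloor$; while $E(t)+E(T-t)<n$ replace $t$ by $t-1$; set $\mathrm{kMax}:=E(t)$; - (testing the sums) for $m=6,\dots,\mathrm{kMax}$: if $\mathrm{Compl}[m]+\mathrm{Compl}[n-m]<\mathrm{Compl}[n]$,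 set $\mathrm{Compl}[n]:=\mathrm{Compl}[m]+\mathrm{Compl}[n-m]$; - (testing the products) for $k=2,\dots,\min(n,\lfloor N/n\rfloor)$: if $\mathrm{Compl}[k]+\mathrm{Compl}[n]<\mathrm{Compl}[kn]$, set $\mathrm{Compl}[kn]:=\mathrm{Compl}[k]+\mathrm{Compl}[n]$. The algorithm is run on a random access machine with finitely many registers and one array, written as a program of elementary instructions (assignment; addition, subtraction, multiplication, integer division; reading, writing or appending an array entry; comparison), where $\mathrm{cMax}$ is obtained as the number of binary digits of $N^3$ by repeated halving. Time is the number of elementary instructions executed, and space is the maximum over the run of the number of bits occupied by the registers and the array, the array being stored with cells of a common width. **Theorem.** For every $N\ge 1$ the algorithm terminates without a fault (no negative difference, no division by zero, no array index out of range) with $\mathrm{Compl}[n]=\Vert n\Vert$ for all $1\le n\le N$. As $N\to\infty$ it runs in time $O(N^{1.230175})$ and space $O(N\log\log N)$, and all numbers stored during the run have $O(\log N)$ bits. -/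

import Mathlib

open scoped Asymptotics

/-! ### Integer complexity -/

/-- Expressions built from `1` with `+` and `×`. -/
inductive OneExpr : Type
  | one : OneExpr
  | add : OneExpr → OneExpr → OneExpr
  | mul : OneExpr → OneExpr → OneExpr

/-- The positive integer that an expression denotes. -/
def OneExpr.value : OneExpr → ℕ
  | .one => 1
  | .add a b => a.value + b.value
  | .mul a b => a.value * b.value

/-- The number of `1`'s written in an expression. -/
def OneExpr.ones : OneExpr → ℕ
  | .one => 1
  | .add a b => a.ones + b.ones
  | .mul a b => a.ones + b.ones

/-- The complexity `‖n‖` of an integer `n ≥ 1`: the least number of `1`'s in an expression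
for `n`. (It is only used for `n ≥ 1`.) -/
noncomputable def intComplexity (n : ℕ) : ℕ :=
  sInf {k | ∃ e : OneExpr, e.value = n ∧ e.ones = k}

/-! ### A random access machine with structured control

The memory consists of finitely many registers and one growable array of natural numbers.
Programs are in three-address form, so that every intermediate value lies in a register. -/

/-- The registers of the machine. -/
inductive Reg : Type
  | nMax | lim | cMax | q | j | n | d | a | c | target | t | u | e₁ | e₂ | s
  | kMax | m | k | bound | idx | arg | res
  deriving DecidableEq

instance : Fintype Reg where
  elems := {.nMax, .lim, .cMax, .q, .j, .n, .d, .a, .c, .target, .t, .u, .e₁, .e₂, .s,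
    .kMax, .m, .k, .bound, .idx, .arg, .res}
  complete := by intro r; cases r <;> decide

/-- An operand: the content of a register, or a constant of the program text. -/
inductive Opd : Type
  | reg : Reg → Opd
  | lit : ℕ → Opd

/-- The arithmetic operations; `div` is `⌊x / y⌋`. -/
inductive ArithOp : Type
  | add | sub | mul | div

/-- Subtraction faults on a negative result and division faults on a zero divisor. -/
def ArithOp.eval : ArithOp → ℕ → ℕ → Option ℕ
  | .add, x, y => some (x + y)
  | .sub, x, y => if y ≤ x then some (x - y) else none
  | .mul, x, y => some (x * y)
  | .div, x, y => if y = 0 then none else some (x / y)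

/-- A memory state: the registers, and the array (written `Compl`). -/
structure Mem : Type where
  reg : Reg → ℕ
  arr : List ℕ

/-- The value of an operand. -/
def Mem.val (σ : Mem) : Opd → ℕ
  | .reg r => σ.reg r
  | .lit v => v

/-- Overwrite one register. -/
def Mem.put (σ : Mem) (r : Reg) (v : ℕ) : Mem :=
  { σ with reg := Function.update σ.reg r v }

/-- The elementary instructions. -/
inductive Instr : Type
  /-- `r := x` -/
  | move (r : Reg) (x : Opd)
  /-- `r := x op y` -/
  | arith (r : Reg) (op : ArithOp) (x y : Opd)
  /-- `r := Compl[i]` -/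
  | load (r : Reg) (i : Opd)
  /-- `Compl[i] := x` -/
  | store (i x : Opd)
  /-- append `x` at the end of `Compl` -/
  | push (x : Opd)

/-- Execution of an elementary instruction; `none` is a fault (an arithmetic fault, or an
array index out of range). -/
def Instr.eval (σ : Mem) : Instr → Option Mem
  | .move r x => some (σ.put r (σ.val x))
  | .arith r op x y => (op.eval (σ.val x) (σ.val y)).map (σ.put r)
  | .load r i => (σ.arr[σ.val i]?).map (σ.put r)
  | .store i x =>
      if σ.val i < σ.arr.length then
        some { σ with arr := σ.arr.set (σ.val i) (σ.val x) }
      else none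
  | .push x => some { σ with arr := σ.arr ++ [σ.val x] }

/-- Programs. The only tests are comparisons `x < y`. -/
inductive Prog : Type
  | skip : Prog
  | instr : Instr → Prog
  | seq : Prog → Prog → Prog
  | ifLt (x y : Opd) (p q : Prog) : Prog
  | whileLt (x y : Opd) (p : Prog) : Prog

/-- The number of bits that store a natural number (at least one). -/
def bitLen (v : ℕ) : ℕ := max 1 v.size

/-- The cell width that the array needs: the bit length of its largest entry. -/
def Mem.cellWidth (σ : Mem) : ℕ := (σ.arr.map bitLen).foldr max 0

/-- The number of bits that a memory state occupies: the registers, and the array with cells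
of a common width. -/
def Mem.bits (σ : Mem) : ℕ :=
  (∑ r : Reg, bitLen (σ.reg r)) + σ.arr.length * σ.cellWidth

/-- The bit length of the largest number in a memory state. -/
def Mem.width (σ : Mem) : ℕ :=
  max (Finset.univ.sup fun r : Reg => bitLen (σ.reg r)) σ.cellWidth

/-- The resources used by a run: the number of elementary operations, the largest number of
bits occupied at any moment, and the bit length of the largest number ever stored. -/
@[ext]
structure Usage : Type where
  time : ℕ
  space : ℕ
  width : ℕ

/-- One operation carried out in the state `σ`. -/
def Usage.tick (σ : Mem) : Usage := ⟨1, σ.bits, σ.width⟩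

/-- Being in the state `σ`, without an operation. -/
def Usage.rest (σ : Mem) : Usage := ⟨0, σ.bits, σ.width⟩

/-- Resources of two consecutive parts of a run: times add up, peaks are maximized. -/
def Usage.andThen (α β : Usage) : Usage :=
  ⟨α.time + β.time, max α.space β.space, max α.width β.width⟩

/-- `Exec p σ τ ρ`: the program `p`, started in `σ`, terminates without a fault in `τ` and uses
the resources `ρ`. Every elementary instruction and every evaluation of a test costs one unit
of time. -/
inductive Exec : Prog → Mem → Mem → Usage → Prop
  | skip (σ : Mem) : Exec .skip σ σ (.rest σ)
  | instr (i : Instr) (σ τ : Mem) (h : i.eval σ = some τ) :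
      Exec (.instr i) σ τ ((Usage.tick σ).andThen (.rest τ))
  | seq (p q : Prog) (σ τ υ : Mem) (α β : Usage)
      (hp : Exec p σ τ α) (hq : Exec q τ υ β) :
      Exec (.seq p q) σ υ (α.andThen β)
  | ifTrue (x y : Opd) (p q : Prog) (σ τ : Mem) (α : Usage)
      (h : σ.val x < σ.val y) (hp : Exec p σ τ α) :
      Exec (.ifLt x y p q) σ τ ((Usage.tick σ).andThen α)
  | ifFalse (x y : Opd) (p q : Prog) (σ τ : Mem) (α : Usage)
      (h : ¬ σ.val x < σ.val y) (hq : Exec q σ τ α) :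
      Exec (.ifLt x y p q) σ τ ((Usage.tick σ).andThen α)
  | whileTrue (x y : Opd) (p : Prog) (σ τ υ : Mem) (α β : Usage)
      (h : σ.val x < σ.val y) (hp : Exec p σ τ α) (hw : Exec (.whileLt x y p) τ υ β) :
      Exec (.whileLt x y p) σ υ ((Usage.tick σ).andThen (α.andThen β))
  | whileFalse (x y : Opd) (p : Prog) (σ : Mem) (h : ¬ σ.val x < σ.val y) :
      Exec (.whileLt x y p) σ σ (.tick σ)

/-- The final state and the resources are determined by the program and the initial state. -/
theorem Exec.det {p : Prog} {σ τ τ' : Mem} {α α' : Usage}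
    (h : Exec p σ τ α) (h' : Exec p σ τ' α') : τ = τ' ∧ α = α' := by
  induction h generalizing τ' α' <;> cases h' <;> grind

/-! ### The time-improved algorithm -/

namespace TimeImproved

/-- Sequential composition of a list of programs. -/
def block : List Prog → Prog
  | [] => .skip
  | p :: ps => .seq p (block ps)

/-- The content of a register, as an operand. -/
def R (r : Reg) : Opd := .reg r

/-- A constant, as an operand. -/
def K (v : ℕ) : Opd := .lit v

def move (r : Reg) (x : Opd) : Prog := .instr (.move r x)
def add (r : Reg) (x y : Opd) : Prog := .instr (.arith r .add x y)
def sub (r : Reg) (x y : Opd) : Prog := .instr (.arith r .sub x y)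
def mul (r : Reg) (x y : Opd) : Prog := .instr (.arith r .mul x y)
def div (r : Reg) (x y : Opd) : Prog := .instr (.arith r .div x y)
def load (r : Reg) (i : Opd) : Prog := .instr (.load r i)
def store (i x : Opd) : Prog := .instr (.store i x)
def push (x : Opd) : Prog := .instr (.push x)

open Reg

/-- `out := E(x)`, the function `E` being computed as follows:
`E(0) = 1`; otherwise `result = 1; while n > 4: result *= 3; n -= 3; return result * n`. -/
def computeE (out : Reg) (x : Reg) : Prog :=
  .ifLt (R x) (K 1)
    (move out (K 1))
    (block [
      move res (K 1),
      move arg (R x),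
      .whileLt (K 4) (R arg) (block [
        mul res (R res) (K 3),
        sub arg (R arg) (K 3)]),
      mul out (R res) (R arg)])

/-- `cMax := ⌊3 log nMax / log 2⌋ + 1` (this is the number of binary digits of `nMax ^ 3`),
`Compl := [cMax for n in range(0, nMax + 1)]`, `Compl[1] := 1`. -/
def initCompl : Prog :=
  block [
    add lim (R nMax) (K 1),
    mul q (R nMax) (R nMax),
    mul q (R q) (R nMax),
    move cMax (K 0),
    .whileLt (K 0) (R q) (block [
      div q (R q) (K 2),
      add cMax (R cMax) (K 1)]),
    move j (K 0),
    .whileLt (R j) (R lim) (block [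
      push (R cMax),
      add j (R j) (K 1)]),
    store (K 1) (K 1)]

/-- `a := Compl[n-1] + 1; if a < Compl[n]: Compl[n] := a`. -/
def usualBestValue : Prog :=
  block [
    sub d (R n) (K 1),
    load a (R d),
    add a (R a) (K 1),
    load c (R n),
    .ifLt (R a) (R c) (store (R n) (R a)) .skip]

/-- `s := E(t) + E(target - t)`. -/
def sumOfE : Prog :=
  block [
    computeE e₁ t,
    sub u (R target) (R t),
    computeE e₂ u,
    add s (R e₁) (R e₂)]

/-- `target := Compl[n-1]; t := target / 2; while E(t) + E(target - t) < n: t := t - 1;`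
`kMax := E(t)`. -/
def computeKMax : Prog :=
  block [
    sub d (R n) (K 1),
    load target (R d),
    div t (R target) (K 2),
    sumOfE,
    .whileLt (R s) (R n) (block [
      sub t (R t) (K 1),
      sumOfE]),
    computeE kMax t]

/-- `for m in range(6, kMax + 1): if Compl[m] + Compl[n-m] < Compl[n]:`
`Compl[n] := Compl[m] + Compl[n-m]`. -/
def testSums : Prog :=
  block [
    add bound (R kMax) (K 1),
    move m (K 6),
    .whileLt (R m) (R bound) (block [
      load a (R m),
      sub d (R n) (R m),
      load c (R d),
      add a (R a) (R c),
      load c (R n),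
      .ifLt (R a) (R c) (store (R n) (R a)) .skip,
      add m (R m) (K 1)])]

/-- `for k in range(2, min(n, nMax / n) + 1): if Compl[k] + Compl[n] < Compl[k * n]:`
`Compl[k * n] := Compl[k] + Compl[n]`. -/
def testProducts : Prog :=
  block [
    div bound (R nMax) (R n),
    .ifLt (R n) (R bound) (move bound (R n)) .skip,
    add bound (R bound) (K 1),
    move k (K 2),
    .whileLt (R k) (R bound) (block [
      load a (R k),
      load c (R n),
      add a (R a) (R c),
      mul idx (R k) (R n),
      load c (R idx),
      .ifLt (R a) (R c) (store (R idx) (R a)) .skip,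
      add k (R k) (K 1)])]

/-- The whole algorithm: after the initialization, one main loop over `n` in
`range(2, nMax + 1)`. -/
def program : Prog :=
  block [
    initCompl,
    move n (K 2),
    .whileLt (R n) (R lim) (block [
      usualBestValue,
      computeKMax,
      testSums,
      testProducts,
      add n (R n) (K 1)])]

/-- The initial memory: the input `N` in the register `nMax`, all other registers `0`, and an
empty array. -/
def input (N : ℕ) : Mem where
  reg := fun r => if r = nMax then N else 0
  arr := []

end TimeImproved

/-! ### Basic properties of integer complexity -/

/-! Correctness. Cut an optimal expression for n at its last operation (`intComplexity_decompose`).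
If this is a product ab with 2 ≤ a ≤ b, then b < n and the round of b has already tested it. If it
is a sum a + b with a ≤ b and it beats ‖n-1‖ + 1, then ‖a‖ + ‖b‖ ≤ T := ‖n-1‖. Since x ≤ E(‖x‖) for
every x, the smaller of the two complexities passes the test E(s) + E(T-s) ≥ n. Hence a ≤ E(t) =
kMax for the cutoff t (`IsSumCutoff.le_maxVal`), and the loop reaches a unless a < 6. Summands below
6 have ‖a‖ = a and cannot beat the route through n-1.

Time. The larger of E(t) and E(T-t) is at least n/2, and E(t)E(T-t) ≤ E(T). So kMax ≤ 2E(T)/n, where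
E(T) ≤ 3^(T/3), and the sums cost O(∑ 3^(‖n‖/3)/n) in all. Everything else is O(N log² N): finding
the cutoffs takes O(log² N) per round, and the products form a harmonic sum.

The weights w(n) = 3^(‖n‖/3)/n are controlled by division with remainder: ‖n‖ ≤ ‖⌊n/p⌋‖ + p + (n mod
p). On a residue class modulo a product b of 2s and 3s, iterating this bounds w(n) by a constant
times w(⌊n/b⌋). If the residue classes partition the integers, the partial sums S of w satisfy S(N)
≤ B + ∑ κ b^1.23 S(N/b), with one constant κ for each class. Induction then gives S(N) = O(N^1.23)
as soon as ∑ κ < 1 (`exists_weightSum_le`). An explicit partition, `CoverTree.cover`, has this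
property, verified in integer arithmetic (`CoverTree.cover_weight_lt_one`).

Space. Array entries never exceed cMax = O(log N), so each of the N + 1 cells needs O(log log N)
bits. The registers stay polynomial in N. The Hoare triple `Runs` carries termination, absence of
faults, time and these limits together. -/

theorem OneExpr.ones_pos (e : OneExpr) : 1 ≤ e.ones := by
  induction e <;> simp only [OneExpr.ones] <;> omega

theorem OneExpr.value_pos (e : OneExpr) : 1 ≤ e.value := by
  induction e with
  | one => simp [OneExpr.value]
  | add a b iha ihb => simp only [OneExpr.value]; omega
  | mul a b iha ihb => exact Nat.mul_pos iha ihb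

theorem intComplexity_le_ones (e : OneExpr) : intComplexity e.value ≤ e.ones :=
  Nat.sInf_le ⟨e, rfl, rfl⟩

theorem exists_oneExpr_value {n : ℕ} (hn : 1 ≤ n) : ∃ e : OneExpr, e.value = n := by
  induction n, hn using Nat.le_induction with
  | base => exact ⟨.one, rfl⟩
  | succ n _ ih =>
    obtain ⟨e, he⟩ := ih
    exact ⟨.add e .one, by simp [OneExpr.value, he]⟩

theorem exists_oneExpr_ones_eq {n : ℕ} (hn : 1 ≤ n) :
    ∃ e : OneExpr, e.value = n ∧ e.ones = intComplexity n := by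
  obtain ⟨e, he⟩ := exists_oneExpr_value hn
  exact Nat.sInf_mem (s := {k | ∃ e : OneExpr, e.value = n ∧ e.ones = k}) ⟨e.ones, e, he, rfl⟩

theorem intComplexity_pos {n : ℕ} (hn : 1 ≤ n) : 1 ≤ intComplexity n := by
  obtain ⟨e, -, he⟩ := exists_oneExpr_ones_eq hn
  exact he ▸ e.ones_pos

theorem intComplexity_add_le {a b : ℕ} (ha : 1 ≤ a) (hb : 1 ≤ b) :
    intComplexity (a + b) ≤ intComplexity a + intComplexity b := by
  obtain ⟨x, rfl, hx⟩ := exists_oneExpr_ones_eq ha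
  obtain ⟨y, rfl, hy⟩ := exists_oneExpr_ones_eq hb
  rw [← hx, ← hy]
  exact intComplexity_le_ones (.add x y)

theorem intComplexity_mul_le {a b : ℕ} (ha : 1 ≤ a) (hb : 1 ≤ b) :
    intComplexity (a * b) ≤ intComplexity a + intComplexity b := by
  obtain ⟨x, rfl, hx⟩ := exists_oneExpr_ones_eq ha
  obtain ⟨y, rfl, hy⟩ := exists_oneExpr_ones_eq hb
  rw [← hx, ← hy]
  exact intComplexity_le_ones (.mul x y)

theorem intComplexity_one : intComplexity 1 = 1 :=
  le_antisymm (intComplexity_le_ones .one) (intComplexity_pos le_rfl)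

theorem intComplexity_succ_le {n : ℕ} (hn : 1 ≤ n) :
    intComplexity (n + 1) ≤ intComplexity n + 1 := by
  simpa only [intComplexity_one] using intComplexity_add_le hn le_rfl

theorem intComplexity_add_le_add {n : ℕ} (hn : 1 ≤ n) (k : ℕ) :
    intComplexity (n + k) ≤ intComplexity n + k := by
  induction k with
  | zero => rfl
  | succ k ih =>
    have := intComplexity_succ_le (n := n + k) (by omega)
    rw [← add_assoc]; omega

theorem intComplexity_le_self {n : ℕ} (hn : 1 ≤ n) : intComplexity n ≤ n := by
  have h := intComplexity_add_le_add le_rfl (n - 1)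
  rw [intComplexity_one] at h
  rwa [Nat.add_sub_cancel' hn] at h

/-- The last operation of an optimal expression. Both operands must be optimal as well, and a factor
1 would be a wasted symbol. -/
theorem intComplexity_decompose {n : ℕ} (hn : 2 ≤ n) :
    (∃ a b, 1 ≤ a ∧ a ≤ b ∧ a + b = n ∧ intComplexity a + intComplexity b = intComplexity n) ∨
    (∃ a b, 2 ≤ a ∧ a ≤ b ∧ a * b = n ∧ intComplexity a + intComplexity b = intComplexity n) := by
  obtain ⟨e, hv, ho⟩ := exists_oneExpr_ones_eq (n := n) (by omega)
  cases e with
  | one => simp [OneExpr.value] at hv; omega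
  | add x y =>
    left
    simp only [OneExpr.value, OneExpr.ones] at hv ho
    have hx := intComplexity_le_ones x
    have hy := intComplexity_le_ones y
    have h := intComplexity_add_le x.value_pos y.value_pos
    rw [hv] at h
    rcases le_total x.value y.value with hxy | hxy
    · exact ⟨_, _, x.value_pos, hxy, hv, by omega⟩
    · exact ⟨_, _, y.value_pos, hxy, by omega, by omega⟩
  | mul x y =>
    right
    simp only [OneExpr.value, OneExpr.ones] at hv ho
    have hx := intComplexity_le_ones x
    have hy := intComplexity_le_ones y
    have hx1 := x.ones_pos
    have hy1 := y.ones_pos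
    have h := intComplexity_mul_le x.value_pos y.value_pos
    rw [hv] at h
    have hx2 : 2 ≤ x.value := by
      -- If one factor were 1, the other alone would denote n with fewer ones.
      by_contra hlt
      have h1 : x.value = 1 := by have := x.value_pos; omega
      rw [h1, one_mul] at hv
      rw [hv] at hy; omega
    have hy2 : 2 ≤ y.value := by
      by_contra hlt
      have h1 : y.value = 1 := by have := y.value_pos; omega
      rw [h1, mul_one] at hv
      rw [hv] at hx; omega
    rcases le_total x.value y.value with hxy | hxy
    · exact ⟨_, _, hx2, hxy, hv, by omega⟩
    · exact ⟨_, _, hy2, hxy, by rw [mul_comm]; exact hv, by omega⟩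

/-- One division step with remainder. -/
theorem intComplexity_le_div {p n : ℕ} (hp : 1 ≤ p) (hn : p ≤ n) :
    intComplexity n ≤ intComplexity (n / p) + (p + n % p) := by
  have hq : 1 ≤ n / p := (Nat.one_le_div_iff (by omega)).2 hn
  have h1 := intComplexity_mul_le hp hq
  have h2 := intComplexity_add_le_add (Nat.mul_pos hp hq) (n % p)
  rw [Nat.div_add_mod] at h2
  have h3 := intComplexity_le_self hp
  omega

/-- This is ‖n‖ ≤ 3 log₂ n: each halving costs at most three ones, two for the factor and one for
the remainder. -/
theorem two_pow_intComplexity_le {n : ℕ} (hn : 2 ≤ n) : 2 ^ intComplexity n ≤ n ^ 3 := by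
  induction n using Nat.strong_induction_on with
  | _ n ih =>
    by_cases h4 : n < 4
    · have h := Nat.pow_le_pow_right (n := 2) (by norm_num) (intComplexity_le_self (n := n) (by omega))
      refine h.trans ?_
      interval_cases n <;> norm_num
    · have h := intComplexity_le_div (p := 2) (n := n) (by norm_num) hn
      have hq := ih (n / 2) (by omega) (by omega)
      have hle : intComplexity n ≤ intComplexity (n / 2) + 3 := by omega
      calc 2 ^ intComplexity n ≤ 2 ^ (intComplexity (n / 2) + 3) :=
            Nat.pow_le_pow_right (by norm_num) hle
        _ = 2 ^ intComplexity (n / 2) * 2 ^ 3 := pow_add ..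
        _ ≤ (n / 2) ^ 3 * 2 ^ 3 := Nat.mul_le_mul_right _ hq
        _ = (n / 2 * 2) ^ 3 := (mul_pow ..).symm
        _ ≤ n ^ 3 := Nat.pow_le_pow_left (Nat.div_mul_le_self n 2) 3

theorem intComplexity_lt_size {n N : ℕ} (hn : 2 ≤ n) (hN : n ≤ N) :
    intComplexity n < (N ^ 3).size := by
  refine (Nat.pow_lt_pow_iff_right (a := 2) (by norm_num)).1 ?_
  exact ((two_pow_intComplexity_le hn).trans (Nat.pow_le_pow_left hN 3)).trans_lt
    (Nat.lt_size_self _)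

/-- This makes the initial entry `cMax` an upper bound for all the complexities that are sought. -/
theorem intComplexity_le_size {n N : ℕ} (hn : 1 ≤ n) (hN : n ≤ N) :
    intComplexity n ≤ (N ^ 3).size := by
  rcases hn.eq_or_lt with rfl | h
  · rw [intComplexity_one]
    exact Nat.size_pos.2 (by positivity)
  · exact (intComplexity_lt_size h hN).le

/-! ### The largest integer of a given complexity -/

/-- The value of the procedure `E`: the largest integer of complexity at most `n`. -/
def maxVal : ℕ → ℕ
  | 0 => 1
  | 1 => 1
  | 2 => 2
  | 3 => 3
  | 4 => 4
  | n + 5 => 3 * maxVal (n + 2)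

theorem maxVal_add_three {n : ℕ} (hn : 2 ≤ n) : maxVal (n + 3) = 3 * maxVal n := by
  obtain ⟨k, rfl⟩ := Nat.exists_eq_add_of_le' hn
  rfl

theorem maxVal_eq_self {n : ℕ} (h1 : 1 ≤ n) (h4 : n ≤ 4) : maxVal n = n := by
  interval_cases n <;> rfl

theorem maxVal_pos (n : ℕ) : 1 ≤ maxVal n := by
  induction n using maxVal.induct <;> simp only [maxVal] <;> omega

theorem maxVal_lt_succ {n : ℕ} (hn : 1 ≤ n) : maxVal n < maxVal (n + 1) := by
  induction n using Nat.strong_induction_on with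
  | _ n ih =>
    by_cases h : n < 5
    · interval_cases n <;> decide
    · obtain ⟨k, rfl⟩ := Nat.exists_eq_add_of_le' (not_lt.1 h)
      have := ih (k + 2) (by omega) (by omega)
      change 3 * maxVal (k + 2) < 3 * maxVal (k + 2 + 1)
      omega

theorem maxVal_mono : Monotone maxVal := by
  refine monotone_nat_of_le_succ fun n => ?_
  rcases n.eq_zero_or_pos with rfl | h
  · decide
  · exact (maxVal_lt_succ h).le

/-- Factors 3 can be stripped from either side as long as its argument is at least 5; what remains
is a finite table. -/
theorem maxVal_mul_le (a b : ℕ) : maxVal a * maxVal b ≤ maxVal (a + b) := by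
  induction h : a + b using Nat.strong_induction_on generalizing a b with
  | _ s ih =>
    subst h
    by_cases ha : 5 ≤ a
    · obtain ⟨k, rfl⟩ := Nat.exists_eq_add_of_le' ha
      have := ih (k + 2 + b) (by omega) (k + 2) b rfl
      rw [show k + 5 + b = (k + 2 + b) + 3 by ring, maxVal_add_three (n := k + 2 + b) (by omega),
        show maxVal (k + 5) = 3 * maxVal (k + 2) from rfl, mul_assoc]
      omega
    · by_cases hb : 5 ≤ b
      · obtain ⟨k, rfl⟩ := Nat.exists_eq_add_of_le' hb
        have := ih (a + (k + 2)) (by omega) a (k + 2) rfl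
        rw [show a + (k + 5) = (a + (k + 2)) + 3 by ring, maxVal_add_three (n := a + (k + 2)) (by omega),
          show maxVal (k + 5) = 3 * maxVal (k + 2) from rfl, mul_left_comm]
        omega
      · have ha' : a < 5 := by omega
        have hb' : b < 5 := by omega
        interval_cases a <;> interval_cases b <;> decide

theorem two_le_maxVal {n : ℕ} (hn : 2 ≤ n) : 2 ≤ maxVal n := maxVal_mono hn

/-- For arguments at least 2 a sum is at most the product of the same values; an argument 1 is
covered by strict monotonicity. -/
theorem maxVal_add_le {a b : ℕ} (ha : 1 ≤ a) (hb : 1 ≤ b) :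
    maxVal a + maxVal b ≤ maxVal (a + b) := by
  rcases ha.eq_or_lt with rfl | ha
  · have := maxVal_lt_succ hb
    rw [add_comm 1 b, show maxVal 1 = 1 from rfl]; omega
  rcases hb.eq_or_lt with rfl | hb
  · have := maxVal_lt_succ (n := a) (by omega)
    rw [show maxVal 1 = 1 from rfl]; omega
  refine le_trans ?_ (maxVal_mul_le a b)
  exact Nat.add_le_mul (two_le_maxVal ha) (two_le_maxVal hb)

theorem OneExpr.value_le_maxVal (e : OneExpr) : e.value ≤ maxVal e.ones := by
  induction e with
  | one => exact le_rfl
  | add a b iha ihb => exact (add_le_add iha ihb).trans (maxVal_add_le a.ones_pos b.ones_pos)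
  | mul a b iha ihb => exact (Nat.mul_le_mul iha ihb).trans (maxVal_mul_le _ _)

theorem le_maxVal_intComplexity {n : ℕ} (hn : 1 ≤ n) : n ≤ maxVal (intComplexity n) := by
  obtain ⟨e, hv, ho⟩ := exists_oneExpr_ones_eq hn
  simpa only [hv, ho] using e.value_le_maxVal

theorem maxVal_pow_three_le (n : ℕ) : maxVal n ^ 3 ≤ 3 ^ n := by
  induction n using maxVal.induct with
  | case6 n ih =>
    calc maxVal (n + 5) ^ 3 = 27 * maxVal (n + 2) ^ 3 := by rw [maxVal]; ring
      _ ≤ 27 * 3 ^ (n + 2) := Nat.mul_le_mul_left _ ih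
      _ = 3 ^ (n + 5) := by ring
  | _ => decide

/-- Combines E(k)³ ≤ 3^k ≤ 4^k with 2^k ≤ n³. It keeps all values of E that the algorithm computes
within the register limits. -/
theorem maxVal_intComplexity_le_sq {n : ℕ} (hn : 1 ≤ n) : maxVal (intComplexity n) ≤ n ^ 2 := by
  rcases hn.eq_or_lt with rfl | h
  · rw [intComplexity_one]; decide
  · refine (Nat.pow_le_pow_iff_left (n := 3) (by norm_num)).1 ?_
    calc maxVal (intComplexity n) ^ 3 ≤ 3 ^ intComplexity n := maxVal_pow_three_le _
      _ ≤ 4 ^ intComplexity n := Nat.pow_le_pow_left (by norm_num) _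
      _ = (2 ^ intComplexity n) ^ 2 := by rw [← pow_mul, mul_comm, pow_mul]; norm_num
      _ ≤ (n ^ 3) ^ 2 := Nat.pow_le_pow_left (two_pow_intComplexity_le h) 2
      _ = (n ^ 2) ^ 3 := by ring

theorem maxVal_half_intComplexity_le {n t : ℕ} (hn : 1 ≤ n) (ht : 2 * t ≤ intComplexity n) :
    maxVal t ≤ n := by
  refine (Nat.pow_le_pow_iff_left (n := 2) (by norm_num)).1 ?_
  calc maxVal t ^ 2 = maxVal t * maxVal t := sq _
    _ ≤ maxVal (t + t) := maxVal_mul_le _ _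
    _ ≤ maxVal (intComplexity n) := maxVal_mono (by omega)
    _ ≤ n ^ 2 := maxVal_intComplexity_le_sq hn

/-! ### The range of summands that has to be searched -/

/-- `t` is the largest number below half of `‖n - 1‖` with `E(t) + E(‖n - 1‖ - t) ≥ n`. -/
structure IsSumCutoff (n t : ℕ) : Prop where
  two_mul_le : 2 * t ≤ intComplexity (n - 1)
  le_add : n ≤ maxVal t + maxVal (intComplexity (n - 1) - t)
  lt_of_lt : ∀ s, t < s → 2 * s ≤ intComplexity (n - 1) →
    maxVal s + maxVal (intComplexity (n - 1) - s) < n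

/-- Let s ≤ u be the two complexities. Raising u to ‖n-1‖ - s keeps E(s) + E(u) ≥ n, so s passes the
test and s ≤ t. The summand of complexity s is at most E(t), and it is a or the larger b. -/
theorem IsSumCutoff.le_maxVal {n t a b : ℕ} (h : IsSumCutoff n t) (ha : 1 ≤ a) (hab : a ≤ b)
    (hn : a + b = n) (hc : intComplexity a + intComplexity b ≤ intComplexity (n - 1)) :
    a ≤ maxVal t := by
  have hA := le_maxVal_intComplexity ha
  have hB := le_maxVal_intComplexity (ha.trans hab)
  have key : ∀ s u, s ≤ u → s + u ≤ intComplexity (n - 1) → n ≤ maxVal s + maxVal u → s ≤ t := by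
    intro s u hsu hs hle
    by_contra hlt
    have h1 := h.lt_of_lt s (by omega) (by omega)
    have h2 : maxVal u ≤ maxVal (intComplexity (n - 1) - s) := maxVal_mono (by omega)
    omega
  rcases le_total (intComplexity a) (intComplexity b) with hle | hle
  · exact hA.trans (maxVal_mono (key _ _ hle hc (by omega)))
  · exact hab.trans (hB.trans (maxVal_mono (key _ _ hle (by omega) (by omega))))

/-- Every tested m is thus smaller than n, so `Compl[m]` and `Compl[n-m]` are already final. -/
theorem IsSumCutoff.maxVal_lt {n t : ℕ} (hn : 2 ≤ n) (h : IsSumCutoff n t) : maxVal t < n := by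
  have := maxVal_half_intComplexity_le (n := n - 1) (by omega) h.two_mul_le
  omega

/-- E(T-t) is the larger term of a sum that is at least n, hence at least n/2, while E(t)E(T-t) ≤
E(T). The time bound rests on this. -/
theorem IsSumCutoff.maxVal_le_div {n t : ℕ} (hn : 2 ≤ n) (h : IsSumCutoff n t) :
    maxVal t ≤ 2 * maxVal (intComplexity (n - 1)) / n := by
  rw [Nat.le_div_iff_mul_le (by omega)]
  have hT := h.two_mul_le
  have h1 : maxVal t ≤ maxVal (intComplexity (n - 1) - t) := maxVal_mono (by omega)
  have h2 := h.le_add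
  have h3 := maxVal_mul_le t (intComplexity (n - 1) - t)
  rw [Nat.add_sub_cancel' (by omega)] at h3
  calc maxVal t * n ≤ maxVal t * (2 * maxVal (intComplexity (n - 1) - t)) :=
        Nat.mul_le_mul_left _ (by omega)
    _ = 2 * (maxVal t * maxVal (intComplexity (n - 1) - t)) := by ring
    _ ≤ _ := Nat.mul_le_mul_left _ h3

/-- A value that passed all the tests of the algorithm is the complexity. -/
theorem eq_intComplexity_of_tests {n t v : ℕ} (hn : 2 ≤ n) (ht : IsSumCutoff n t)
    (hlow : intComplexity n ≤ v) (hsucc : v ≤ intComplexity (n - 1) + 1)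
    (hsum : ∀ m, 6 ≤ m → m ≤ maxVal t → v ≤ intComplexity m + intComplexity (n - m))
    (hprod : ∀ a b, 2 ≤ a → a ≤ b → a * b = n → v ≤ intComplexity a + intComplexity b) :
    v = intComplexity n := by
  refine le_antisymm ?_ hlow
  rcases intComplexity_decompose hn with ⟨a, b, ha, hab, hs, hc⟩ | ⟨a, b, ha, hab, hs, hc⟩
  · by_contra! hlt
    -- The value v exceeds ‖n‖ but not ‖n-1‖ + 1, which puts the sum within the budget ‖n-1‖.
    have hle : intComplexity a + intComplexity b ≤ intComplexity (n - 1) := by omega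
    have hat := ht.le_maxVal ha hab hs hle
    by_cases h6 : 6 ≤ a
    · have := hsum a h6 hat
      rw [show n - a = b by omega] at this
      omega
    · have h1 := intComplexity_add_le_add (n := b) (by omega) (a - 1)
      rw [show b + (a - 1) = n - 1 by omega] at h1
      have h2 : a ≤ intComplexity a := by
        have := le_maxVal_intComplexity ha
        by_contra hcon
        have h3 : maxVal (intComplexity a) ≤ maxVal (a - 1) := maxVal_mono (by omega)
        have h4 : maxVal (a - 1) < a := by
          -- E(a-1) < a holds for 2 ≤ a ≤ 5 but fails at 6, because E(5) = 6; this is why the loop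
          -- starts at m = 6.
          have : a < 6 := by omega
          have : a ≠ 1 := by
            rintro rfl
            have := intComplexity_one; omega
          interval_cases a <;> simp_all [maxVal]
        omega
      omega
  · exact (hprod a b ha hab hs).trans hc.le

/-! ### Hoare triples with resource bounds -/

/-- Bounds for the content of a memory state. -/
structure Limits : Type where
  /-- bound for the registers -/
  val : ℕ
  /-- bound for the length of the array -/
  len : ℕ
  /-- bound for the entries of the array -/
  cell : ℕ

/-- The largest space that the limits allow. -/
def Limits.space (l : Limits) : ℕ := Fintype.card Reg * bitLen l.val + l.len * bitLen l.cell

/-- The largest bit length that the limits allow. -/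
def Limits.width (l : Limits) : ℕ := max (bitLen l.val) (bitLen l.cell)

/-- The memory state obeys the limits. -/
structure Mem.Within (l : Limits) (σ : Mem) : Prop where
  reg_le : ∀ r, σ.reg r ≤ l.val
  length_le : σ.arr.length ≤ l.len
  mem_le : ∀ x ∈ σ.arr, x ≤ l.cell

theorem bitLen_mono : Monotone bitLen := fun _ _ h =>
  max_le_max le_rfl (Nat.size_le_size h)

theorem Mem.Within.cellWidth_le {l : Limits} {σ : Mem} (h : σ.Within l) :
    σ.cellWidth ≤ bitLen l.cell := by
  have key : ∀ xs : List ℕ, (∀ x ∈ xs, x ≤ l.cell) →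
      (xs.map bitLen).foldr max 0 ≤ bitLen l.cell := by
    intro xs
    induction xs with
    | nil => intro _; exact Nat.zero_le _
    | cons x xs ih =>
      intro hx
      simp only [List.map_cons, List.foldr_cons]
      exact max_le (bitLen_mono (hx x (by simp))) (ih fun y hy => hx y (by simp [hy]))
  exact key _ h.mem_le

theorem Mem.Within.bits_le {l : Limits} {σ : Mem} (h : σ.Within l) : σ.bits ≤ l.space := by
  refine add_le_add ?_ (Nat.mul_le_mul h.length_le h.cellWidth_le)
  calc ∑ r : Reg, bitLen (σ.reg r) ≤ ∑ _r : Reg, bitLen l.val :=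
        Finset.sum_le_sum fun r _ => bitLen_mono (h.reg_le r)
    _ = Fintype.card Reg * bitLen l.val := by simp

theorem Mem.Within.width_le {l : Limits} {σ : Mem} (h : σ.Within l) : σ.width ≤ l.width :=
  max_le_max (Finset.sup_le fun r _ => bitLen_mono (h.reg_le r)) h.cellWidth_le

theorem Mem.Within.put {l : Limits} {σ : Mem} (h : σ.Within l) (r : Reg) {v : ℕ}
    (hv : v ≤ l.val) : (σ.put r v).Within l where
  reg_le r' := by
    by_cases hr : r' = r
    · subst hr; simpa [Mem.put] using hv
    · simpa [Mem.put, hr] using h.reg_le r'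
  length_le := h.length_le
  mem_le := h.mem_le

/-- Started in `σ`, the program terminates without a fault in a state with property `Q`, takes at
most `T` steps, and obeys the limits `l`. -/
def Runs (l : Limits) (p : Prog) (σ : Mem) (T : ℕ) (Q : Mem → Prop) : Prop :=
  ∃ τ ρ, Exec p σ τ ρ ∧ ρ.time ≤ T ∧ ρ.space ≤ l.space ∧ ρ.width ≤ l.width ∧ τ.Within l ∧ Q τ

namespace Runs

variable {l : Limits} {p q : Prog} {σ τ : Mem} {T T' : ℕ} {Q Q' : Mem → Prop} {x y : Opd}

theorem mono (h : Runs l p σ T Q) (hT : T ≤ T') (hQ : ∀ τ, τ.Within l → Q τ → Q' τ) :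
    Runs l p σ T' Q' := by
  obtain ⟨τ, ρ, he, ht, hs, hw, hl, hq⟩ := h
  exact ⟨τ, ρ, he, ht.trans hT, hs, hw, hl, hQ τ hl hq⟩

theorem of_le (h : Runs l p σ T Q) (hT : T ≤ T') : Runs l p σ T' Q := h.mono hT fun _ _ h => h

theorem skip (hσ : σ.Within l) (hQ : Q σ) : Runs l .skip σ T Q :=
  ⟨σ, _, .skip σ, Nat.zero_le _, hσ.bits_le, hσ.width_le, hσ, hQ⟩

theorem instr {i : Instr} (hσ : σ.Within l) (h : i.eval σ = some τ) (hτ : τ.Within l)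
    (hT : 1 ≤ T) (hQ : Q τ) : Runs l (.instr i) σ T Q :=
  ⟨τ, _, .instr i σ τ h, hT, max_le hσ.bits_le hτ.bits_le, max_le hσ.width_le hτ.width_le,
    hτ, hQ⟩

/-- The postcondition of the first part is itself a run of the second, so that a triple for a block
is built instruction by instruction. -/
theorem seq (hp : Runs l p σ T fun τ => Runs l q τ T' Q) : Runs l (.seq p q) σ (T + T') Q := by
  obtain ⟨τ, ρ, he, ht, hs, hw, -, υ, ρ', he', ht', hs', hw', hl, hq⟩ := hp
  exact ⟨υ, _, .seq p q σ τ υ ρ ρ' he he', add_le_add ht ht', max_le hs hs', max_le hw hw', hl, hq⟩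

theorem ifLt (hσ : σ.Within l) (hp : σ.val x < σ.val y → Runs l p σ T Q)
    (hq : ¬ σ.val x < σ.val y → Runs l q σ T Q) : Runs l (.ifLt x y p q) σ (T + 1) Q := by
  by_cases h : σ.val x < σ.val y
  · obtain ⟨τ, ρ, he, ht, hs, hw, hl, hQ⟩ := hp h
    exact ⟨τ, _, .ifTrue x y p q σ τ ρ h he, by simp only [Usage.andThen, Usage.tick]; omega,
      max_le hσ.bits_le hs, max_le hσ.width_le hw, hl, hQ⟩
  · obtain ⟨τ, ρ, he, ht, hs, hw, hl, hQ⟩ := hq h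
    exact ⟨τ, _, .ifFalse x y p q σ τ ρ h he, by simp only [Usage.andThen, Usage.tick]; omega,
      max_le hσ.bits_le hs, max_le hσ.width_le hw, hl, hQ⟩

/-- A loop with an invariant that is indexed by a bound for the number of further rounds. -/
theorem whileLt {Inv : ℕ → Mem → Prop} {cost : ℕ → ℕ}
    (h : ∀ i σ, σ.Within l → Inv i σ → (¬ σ.val x < σ.val y ∧ Q σ) ∨
      (σ.val x < σ.val y ∧ ∃ j, i = j + 1 ∧ Runs l p σ (cost j) (Inv j)))
    (i : ℕ) (hσ : σ.Within l) (hI : Inv i σ) :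
    Runs l (.whileLt x y p) σ (∑ j ∈ Finset.range i, (cost j + 1) + 1) Q := by
  induction i generalizing σ with
  | zero =>
    rcases h 0 σ hσ hI with ⟨hc, hQ⟩ | ⟨-, j, hj, -⟩
    · exact ⟨σ, _, .whileFalse x y p σ hc, by simp [Usage.tick], hσ.bits_le, hσ.width_le, hσ, hQ⟩
    · omega
  | succ i ih =>
    rcases h (i + 1) σ hσ hI with ⟨hc, hQ⟩ | ⟨hc, j, hj, τ, ρ, he, ht, hs, hw, hl, hIj⟩
    · exact ⟨σ, _, .whileFalse x y p σ hc, by simp [Usage.tick], hσ.bits_le, hσ.width_le, hσ, hQ⟩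
    · obtain rfl : i = j := by omega
      obtain ⟨υ, ρ', he', ht', hs', hw', hl', hQ⟩ := ih hl hIj
      refine ⟨υ, _, .whileTrue x y p σ τ υ ρ ρ' hc he he', ?_,
        max_le hσ.bits_le (max_le hs hs'), max_le hσ.width_le (max_le hw hw'), hl', hQ⟩
      rw [Finset.sum_range_succ]
      simp only [Usage.andThen, Usage.tick]
      omega

/-- A loop with a constant cost of each round. -/
theorem whileLt_const {Inv : ℕ → Mem → Prop} {c : ℕ}
    (h : ∀ i σ, σ.Within l → Inv i σ → (¬ σ.val x < σ.val y ∧ Q σ) ∨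
      (σ.val x < σ.val y ∧ ∃ j, i = j + 1 ∧ Runs l p σ c (Inv j)))
    (i : ℕ) (hσ : σ.Within l) (hI : Inv i σ) (hT : i * (c + 1) + 1 ≤ T) :
    Runs l (.whileLt x y p) σ T Q :=
  (whileLt (cost := fun _ => c) h i hσ hI).mono (by simpa using hT) fun _ _ h => h

open TimeImproved

theorem block_nil (hσ : σ.Within l) (hQ : Q σ) : Runs l (block []) σ 0 Q := skip hσ hQ

theorem block_cons {ps : List Prog} (hp : Runs l p σ T fun τ => Runs l (block ps) τ T' Q) :
    Runs l (block (p :: ps)) σ (T + T') Q := seq hp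

variable {r : Reg} {ps : List Prog}

theorem move (hσ : σ.Within l) (hv : σ.val x ≤ l.val)
    (hps : (σ.put r (σ.val x)).Within l → Runs l (block ps) (σ.put r (σ.val x)) T Q) :
    Runs l (block (move r x :: ps)) σ (1 + T) Q :=
  block_cons (instr hσ rfl (hσ.put r hv) le_rfl (hps (hσ.put r hv)))

theorem arith {op : ArithOp} {v : ℕ} (hσ : σ.Within l) (hop : op.eval (σ.val x) (σ.val y) = some v)
    (hv : v ≤ l.val) (hps : (σ.put r v).Within l → Runs l (block ps) (σ.put r v) T Q) :
    Runs l (block (.instr (.arith r op x y) :: ps)) σ (1 + T) Q :=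
  block_cons (instr hσ (by simp [Instr.eval, hop]) (hσ.put r hv) le_rfl (hps (hσ.put r hv)))

theorem add (hσ : σ.Within l) (hv : σ.val x + σ.val y ≤ l.val)
    (hps : (σ.put r (σ.val x + σ.val y)).Within l →
      Runs l (block ps) (σ.put r (σ.val x + σ.val y)) T Q) :
    Runs l (block (add r x y :: ps)) σ (1 + T) Q := arith hσ rfl hv hps

theorem sub (hσ : σ.Within l) (hle : σ.val y ≤ σ.val x)
    (hps : (σ.put r (σ.val x - σ.val y)).Within l →
      Runs l (block ps) (σ.put r (σ.val x - σ.val y)) T Q) (hv : σ.val x ≤ l.val) :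
    Runs l (block (sub r x y :: ps)) σ (1 + T) Q :=
  arith hσ (if_pos hle) ((Nat.sub_le _ _).trans hv) hps

theorem mul (hσ : σ.Within l) (hv : σ.val x * σ.val y ≤ l.val)
    (hps : (σ.put r (σ.val x * σ.val y)).Within l →
      Runs l (block ps) (σ.put r (σ.val x * σ.val y)) T Q) :
    Runs l (block (mul r x y :: ps)) σ (1 + T) Q := arith hσ rfl hv hps

theorem div (hσ : σ.Within l) (hy : σ.val y ≠ 0) (hv : σ.val x ≤ l.val)
    (hps : (σ.put r (σ.val x / σ.val y)).Within l →
      Runs l (block ps) (σ.put r (σ.val x / σ.val y)) T Q) :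
    Runs l (block (div r x y :: ps)) σ (1 + T) Q :=
  arith hσ (if_neg hy) ((Nat.div_le_self _ _).trans hv) hps

theorem load {v : ℕ} (hσ : σ.Within l) (hx : σ.arr[σ.val x]? = some v)
    (hv : v ≤ l.val) (hps : (σ.put r v).Within l → Runs l (block ps) (σ.put r v) T Q) :
    Runs l (block (load r x :: ps)) σ (1 + T) Q :=
  block_cons (instr hσ (by simp [Instr.eval, hx]) (hσ.put r hv) le_rfl (hps (hσ.put r hv)))

theorem store (hσ : σ.Within l) (hx : σ.val x < σ.arr.length) (hv : σ.val y ≤ l.cell)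
    (hQ : Mem.Within l ⟨σ.reg, σ.arr.set (σ.val x) (σ.val y)⟩ →
      Q ⟨σ.reg, σ.arr.set (σ.val x) (σ.val y)⟩) :
    Runs l (store x y) σ 1 Q := by
  have hw : Mem.Within l ⟨σ.reg, σ.arr.set (σ.val x) (σ.val y)⟩ := by
    refine ⟨hσ.reg_le, by simpa using hσ.length_le, fun z hz => ?_⟩
    rcases List.mem_or_eq_of_mem_set hz with h | rfl
    · exact hσ.mem_le z h
    · exact hv
  exact instr hσ (if_pos hx) hw le_rfl (hQ hw)

theorem push (hσ : σ.Within l) (hlen : σ.arr.length < l.len) (hv : σ.val x ≤ l.cell)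
    (hQ : Mem.Within l ⟨σ.reg, σ.arr ++ [σ.val x]⟩ → Q ⟨σ.reg, σ.arr ++ [σ.val x]⟩) :
    Runs l (push x) σ 1 Q := by
  have hw : Mem.Within l ⟨σ.reg, σ.arr ++ [σ.val x]⟩ := by
    refine ⟨hσ.reg_le, by simpa using hlen, fun z hz => ?_⟩
    rcases List.mem_append.1 hz with h | h
    · exact hσ.mem_le z h
    · rw [List.mem_singleton.1 h]; exact hv
  exact instr hσ rfl hw le_rfl (hQ hw)

end Runs

/-- The array with entries `f 0, …, f N`. -/
def table (N : ℕ) (f : ℕ → ℕ) : List ℕ := (List.range (N + 1)).map f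

theorem length_table (N : ℕ) (f : ℕ → ℕ) : (table N f).length = N + 1 := by simp [table]

theorem table_getElem? {N i : ℕ} (f : ℕ → ℕ) (hi : i ≤ N) : (table N f)[i]? = some (f i) := by
  simp [table, List.getElem?_range (Nat.lt_succ_of_le hi)]

theorem table_set (N i v : ℕ) (f : ℕ → ℕ) :
    (table N f).set i v = table N (Function.update f i v) := by
  refine List.ext_getElem (by simp [table]) fun j h₁ h₂ => ?_
  simp [table, List.getElem_set, Function.update_apply, eq_comm]

namespace TimeImproved

open Reg

/-! ### Reading registers -/

@[simp] theorem val_R (σ : Mem) (r : Reg) : σ.val (R r) = σ.reg r := rfl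

@[simp] theorem val_K (σ : Mem) (v : ℕ) : σ.val (K v) = v := rfl

@[simp] theorem put_arr (σ : Mem) (r : Reg) (v : ℕ) : (σ.put r v).arr = σ.arr := rfl

@[simp] theorem put_reg (σ : Mem) (r r' : Reg) (v : ℕ) :
    (σ.put r v).reg r' = if r' = r then v else σ.reg r' := by
  simp [Mem.put, Function.update_apply]

variable {l : Limits} {σ : Mem} {Q : Mem → Prop}

/-! ### The function `E` -/

/-- The loop preserves res · E(arg) = E(x), because E(a) = 3E(a-3) for a ≥ 5. As E ≥ 1, this also
keeps `res` within the limits. `x` must not be `res`, which is overwritten before `x` is read. -/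
theorem runs_computeE {out x : Reg} (hσ : σ.Within l) (hx : x ≠ res)
    (hE : maxVal (σ.reg x) ≤ l.val)
    (hQ : ∀ τ, τ.Within l → τ.arr = σ.arr → τ.reg out = maxVal (σ.reg x) →
      (∀ r, r ≠ out → r ≠ res → r ≠ arg → τ.reg r = σ.reg r) → Q τ) :
    Runs l (computeE out x) σ (3 * σ.reg x + 6) Q := by
  have h1 : 1 ≤ l.val := (maxVal_pos _).trans hE
  refine Runs.ifLt (T := 3 * σ.reg x + 5) hσ (fun h => ?_) fun h => ?_
  · have h0 : σ.reg x = 0 := by simpa using h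
    have hw := hσ.put out h1
    refine Runs.instr hσ rfl hw (by omega) (hQ _ hw rfl ?_ ?_)
    · simp [h0, maxVal]
    · intro r hr _ _; simp [hr]
  · have hpos : 1 ≤ σ.reg x := by simpa [Nat.one_le_iff_ne_zero] using h
    apply Runs.of_le
    · refine Runs.move hσ h1 fun h₁ => Runs.move h₁ (h₁.reg_le _) fun h₂ =>
        Runs.block_cons (T := 3 * σ.reg x + 1) (T' := 1) ?_
      refine Runs.whileLt_const (c := 2)
        (Inv := fun i τ => τ.arr = σ.arr ∧ τ.reg res * maxVal (τ.reg arg) = maxVal (σ.reg x) ∧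
          1 ≤ τ.reg arg ∧ τ.reg arg ≤ i ∧ ∀ r, r ≠ res → r ≠ arg → τ.reg r = σ.reg r)
        ?_ (σ.reg x) h₂ ?_ (by omega)
      · rintro i τ hτ ⟨harr, hmul, harg, hi, hfr⟩
        have hbound : τ.reg res * maxVal (τ.reg arg) ≤ l.val := hmul ▸ hE
        by_cases h4 : 4 < τ.reg arg
        · right
          refine ⟨h4, i - 1, by omega, ?_⟩
          have hm : maxVal (τ.reg arg) = 3 * maxVal (τ.reg arg - 3) := by
            rw [← maxVal_add_three (by omega)]; congr 1; omega
          have h3 : τ.reg res * 3 * maxVal (τ.reg arg - 3) = maxVal (σ.reg x) := by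
            rw [← hmul, hm, mul_assoc]
          refine Runs.mul hτ ?_ fun h₁ => Runs.sub h₁ ?_ (fun h₂ => Runs.block_nil h₂ ?_) ?_
          · have := Nat.le_mul_of_pos_right (τ.reg res * 3) (maxVal_pos (τ.reg arg - 3))
            simp; omega
          · simp; omega
          · simp
            refine ⟨harr, h3, by omega, by omega, fun r hr hr' => ?_⟩
            simp [hr, hr', hfr]
          · simpa using hτ.reg_le arg
        · left
          refine ⟨by simpa using h4, ?_⟩
          rw [maxVal_eq_self harg (by omega)] at hmul
          refine Runs.mul hτ ?_ fun h₁ => Runs.block_nil h₁ (hQ _ h₁ ?_ ?_ ?_)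
          · simp; omega
          · simpa using harr
          · simpa using hmul
          · intro r hr hr' hr''
            simp [hr, hr', hr'', hfr]
      · simp [hpos, hx]
        intro r hr hr'
        simp [hr, hr']
    · omega

/-! ### Resource limits of the algorithm -/

/-- The limits that the algorithm obeys on the input `N`. -/
def limits (N : ℕ) : Limits := ⟨2 * (N + 1) ^ 3, N + 1, (N ^ 3).size⟩

theorem size_le_self (n : ℕ) : n.size ≤ n := Nat.size_le.2 Nat.lt_two_pow_self

theorem two_mul_cell_le (N : ℕ) : 2 * (limits N).cell ≤ (limits N).val := by
  have h1 := size_le_self (N ^ 3)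
  have h2 := Nat.pow_le_pow_left (Nat.le_succ N) 3
  simp only [limits, Nat.succ_eq_add_one] at *
  omega

/-- Since E(‖n‖) ≤ n², this leaves room in a register for the sum of two values of E. -/
theorem two_mul_sq_le {n N : ℕ} (hn : n ≤ N + 1) : 2 * n ^ 2 ≤ (limits N).val := by
  have h1 := Nat.pow_le_pow_left hn 2
  have h2 := Nat.pow_le_pow_right (n := N + 1) (by omega) (show 2 ≤ 3 by norm_num)
  simp only [limits]
  omega

theorem two_le_val (N : ℕ) : 2 ≤ (limits N).val := by
  simpa using two_mul_sq_le (n := 1) (N := N) (by omega)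

theorem two_mul_succ_le_val (N : ℕ) : 2 * (N + 1) ≤ (limits N).val := by
  have := two_mul_sq_le (n := N + 1) (N := N) le_rfl
  nlinarith

theorem le_cell_of_table {N i : ℕ} {f : ℕ → ℕ} (hσ : σ.Within l) (ha : σ.arr = table N f)
    (hi : i ≤ N) : f i ≤ l.cell :=
  hσ.mem_le _ (ha ▸ List.mem_of_getElem? (table_getElem? f hi))

variable {N : ℕ} {f : ℕ → ℕ}

/-- Lowering an array entry to the content of the register `a`. -/
theorem runs_relax {i : Reg} (hσ : σ.Within l) (ha : σ.arr = table N f) (hi : σ.reg i ≤ N)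
    (hc : σ.reg c = f (σ.reg i))
    (hQ : ∀ τ, τ.Within l → τ.reg = σ.reg →
      τ.arr = table N (Function.update f (σ.reg i) (min (f (σ.reg i)) (σ.reg a))) → Q τ) :
    Runs l (.ifLt (R a) (R c) (store (R i) (R a)) .skip) σ 2 Q := by
  refine Runs.ifLt (T := 1) hσ (fun h => ?_) fun h => ?_
  · simp only [val_R, hc] at h
    refine Runs.store hσ ?_ ?_ fun hw => hQ _ hw rfl ?_
    · simp [ha, length_table]; omega
    · exact h.le.trans (le_cell_of_table hσ ha hi)
    · simp [ha, table_set, min_eq_right h.le]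
  · simp only [val_R, hc] at h
    refine Runs.skip hσ (hQ σ hσ rfl ?_)
    rw [min_eq_left (by omega), Function.update_eq_self, ha]

/-! ### The initialization -/

theorem size_div_two {n : ℕ} (hn : 0 < n) : (n / 2).size + 1 = n.size := by
  have := Nat.size_bit (b := n.bodd) (n := n.div2) (by rw [Nat.bit_bodd_div2]; omega)
  rw [Nat.bit_bodd_div2, Nat.div2_val] at this
  omega

theorem runs_initCompl (hN : 1 ≤ N)
    (hQ : ∀ τ, τ.Within (limits N) → τ.reg nMax = N → τ.reg lim = N + 1 →
      τ.arr = table N (Function.update (fun _ => (N ^ 3).size) 1 1) → Q τ) :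
    Runs (limits N) initCompl (input N) (3 * (N ^ 3).size + 3 * N + 11) Q := by
  have hv := two_mul_succ_le_val N
  have hN2 := two_mul_sq_le (n := N) (N := N) (by omega)
  have hcell := two_mul_cell_le N
  have hσ : (input N).Within (limits N) := by
    refine ⟨fun r => ?_, by simp [input], by simp [input]⟩
    simp only [input]
    split_ifs <;> omega
  have hN3 : N * N * N ≤ (limits N).val := by
    have := Nat.pow_le_pow_left (Nat.le_succ N) 3
    simp only [limits, Nat.succ_eq_add_one] at *
    nlinarith
  apply Runs.of_le
  · refine Runs.add hσ ?_ fun h₁ => Runs.mul h₁ ?_ fun h₂ => Runs.mul h₂ ?_ fun h₃ =>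
      Runs.move h₃ ?_ fun h₄ => Runs.block_cons (T := 3 * (N ^ 3).size + 1)
        (T' := 1 + (3 * N + 5)) ?_
    · simp [input]; omega
    · simp [input]; nlinarith
    · simpa [input] using hN3
    · simp
    -- The digits already counted plus those left in `q` always make up the digits of N³.
    refine Runs.whileLt_const (c := 2)
      (Inv := fun i τ => (τ.reg q).size = i ∧ τ.reg cMax + (τ.reg q).size = (N ^ 3).size ∧
        τ.arr = [] ∧ τ.reg nMax = N ∧ τ.reg lim = N + 1) ?_ (N ^ 3).size h₄ ?_ (by omega)
    · rintro i τ hτ ⟨hi, hs, harr, hn, hl⟩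
      by_cases hq : 0 < τ.reg q
      · right
        have hsz := size_div_two hq
        refine ⟨hq, (τ.reg q / 2).size, by omega, ?_⟩
        refine Runs.div hτ ?_ ?_ fun h₁ => Runs.add h₁ ?_ fun h₂ => Runs.block_nil h₂ ?_
        · simp
        · exact hτ.reg_le q
        · have : (limits N).cell = (N ^ 3).size := rfl
          simp; omega
        · simp [harr, hn, hl]; omega
      · left
        refine ⟨hq, ?_⟩
        have hc : τ.reg cMax = (N ^ 3).size := by
          rw [Nat.eq_zero_of_not_pos hq] at hs; simpa using hs
        refine Runs.move hτ (by simp) fun h₁ => Runs.block_cons (T := 3 * (N + 1) + 1) (T' := 1) ?_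
        refine Runs.whileLt_const (c := 2)
          (Inv := fun i τ => τ.reg j + i = N + 1 ∧ τ.reg cMax = (N ^ 3).size ∧
            τ.arr = (List.range (τ.reg j)).map (fun _ => (N ^ 3).size) ∧
            τ.reg nMax = N ∧ τ.reg lim = N + 1) ?_ (N + 1) h₁ ?_ (by omega)
        · rintro i τ hτ ⟨hi, hc, harr, hn, hl⟩
          by_cases hj : τ.reg j < τ.reg lim
          · right
            refine ⟨hj, i - 1, by omega, ?_⟩
            refine Runs.block_cons (T := 1) (T' := 1) (Runs.push hτ ?_ ?_ fun h₁ =>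
              Runs.add h₁ ?_ fun h₂ => Runs.block_nil h₂ ?_)
            · simp [harr, limits]; omega
            · exact hc.le
            · change τ.reg j + 1 ≤ _; omega
            · simp [hc, harr, hn, hl, List.range_succ]; omega
          · left
            refine ⟨hj, ?_⟩
            have hj' : τ.reg j = N + 1 := by omega
            have ht : τ.arr = table N (fun _ => (N ^ 3).size) := by rw [harr, hj', table]
            refine Runs.block_cons (T := 1) (T' := 0) (Runs.store hτ ?_ ?_ fun h₁ =>
              Runs.block_nil h₁ (hQ _ h₁ hn hl ?_))
            · simp [ht, length_table]; omega
            · exact Nat.size_pos.2 (by positivity)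
            · simp [ht, table_set]
        · simp [hc, harr, hn, hl]
    · simp [input, pow_succ]
  · omega


/-! ### The parts of the main loop -/

theorem runs_usualBestValue (hσ : σ.Within (limits N)) (ha : σ.arr = table N f)
    (hn : 1 ≤ σ.reg n) (hN : σ.reg n ≤ N)
    (hQ : ∀ τ, τ.Within (limits N) → τ.reg nMax = σ.reg nMax → τ.reg lim = σ.reg lim →
      τ.reg n = σ.reg n →
      τ.arr = table N (Function.update f (σ.reg n) (min (f (σ.reg n)) (f (σ.reg n - 1) + 1))) →
      Q τ) :
    Runs (limits N) usualBestValue σ 6 Q := by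
  have h1 := le_cell_of_table (i := σ.reg n) hσ ha hN
  have h2 := le_cell_of_table (i := σ.reg n - 1) hσ ha (by omega)
  have hv := two_mul_cell_le N
  have hv' := two_le_val N
  refine Runs.sub hσ ?_ (fun h₁ => Runs.load (v := f (σ.reg n - 1)) h₁ ?_ ?_ fun h₂ =>
    Runs.add h₂ ?_ fun h₃ => Runs.load (v := f (σ.reg n)) h₃ ?_ ?_ fun h₄ =>
    Runs.block_cons (T := 2) (T' := 0) (runs_relax (N := N) (f := f) h₄ ?_ ?_ ?_
    fun τ hτ hreg harr => Runs.block_nil hτ (hQ τ hτ ?_ ?_ ?_ ?_))) ?_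
  · exact hn
  · simpa [ha] using table_getElem? f (by omega)
  · omega
  · simp; omega
  · simpa [ha] using table_getElem? f (by omega)
  · omega
  · simpa using ha
  · simpa using hN
  · simp
  · simp [hreg]
  · simp [hreg]
  · simp [hreg]
  · simpa using harr
  · exact hσ.reg_le n

theorem runs_sumOfE (hσ : σ.Within l) (ht : σ.reg t ≤ σ.reg target)
    (hE : 2 * maxVal (σ.reg target) ≤ l.val)
    (hQ : ∀ τ, τ.Within l → τ.arr = σ.arr →
      τ.reg s = maxVal (σ.reg t) + maxVal (σ.reg target - σ.reg t) →
      τ.reg t = σ.reg t → τ.reg target = σ.reg target → τ.reg n = σ.reg n →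
      τ.reg nMax = σ.reg nMax → τ.reg lim = σ.reg lim → Q τ) :
    Runs l sumOfE σ (3 * σ.reg target + 14) Q := by
  have hm₁ : maxVal (σ.reg t) ≤ maxVal (σ.reg target) := maxVal_mono ht
  have hm₂ : maxVal (σ.reg target - σ.reg t) ≤ maxVal (σ.reg target) :=
    maxVal_mono (Nat.sub_le _ _)
  apply Runs.of_le
  · refine Runs.block_cons (T := 3 * σ.reg t + 6)
      (T' := 1 + (3 * (σ.reg target - σ.reg t) + 6 + 1)) (runs_computeE hσ (by decide) (by omega)
      fun τ hτ harr he hfr => ?_)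
    have e₁ : τ.reg t = σ.reg t := hfr t (by decide) (by decide) (by decide)
    have e₂ : τ.reg target = σ.reg target := hfr target (by decide) (by decide) (by decide)
    refine Runs.sub hτ (by simp [e₁, e₂, ht]) (fun h₁ => ?_) (hτ.reg_le target)
    have e₃ : (τ.put u (τ.val (R target) - τ.val (R t))).reg u = σ.reg target - σ.reg t := by
      simp [e₁, e₂]
    refine Runs.block_cons (T' := 1) (Runs.of_le (runs_computeE h₁ (by decide) (by rw [e₃]; omega)
      fun υ hυ harr' he' hfr' => ?_) (by omega))
    rw [e₃] at he'
    -- The listed registers survive the subtraction and the second evaluation of E; in particular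
    -- the first value `e₁` does.
    have key : ∀ r, r ∉ [t, target, n, nMax, lim, Reg.e₁] ∨ υ.reg r = τ.reg r := by
      intro r
      cases r <;> first | exact Or.inl (by decide) | refine Or.inr ?_
      all_goals
        rw [hfr' _ (by decide) (by decide) (by decide)]
        simp
    have k₁ : υ.reg Reg.e₁ = maxVal (σ.reg t) := ((key _).resolve_left (by decide)).trans he
    refine Runs.add hυ ?_ fun h₂ => Runs.block_nil h₂ (hQ _ h₂ ?_ ?_ ?_ ?_ ?_ ?_ ?_)
    · simp [k₁, he']; omega
    · simp [harr', harr]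
    · simp [k₁, he']
    all_goals
      simp only [put_reg, reduceCtorEq, if_false]
      rw [(key _).resolve_left (by decide), hfr _ (by decide) (by decide) (by decide)]
  · omega

theorem runs_computeKMax (hσ : σ.Within (limits N)) (ha : σ.arr = table N f)
    (hn : 2 ≤ σ.reg n) (hN : σ.reg n ≤ N) (hf : f (σ.reg n - 1) = intComplexity (σ.reg n - 1))
    (hQ : ∀ τ, τ.Within (limits N) → τ.reg nMax = σ.reg nMax → τ.reg lim = σ.reg lim →
      τ.reg n = σ.reg n → τ.arr = σ.arr →
      (∃ t, IsSumCutoff (σ.reg n) t ∧ τ.reg kMax = maxVal t) → Q τ) :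
    Runs (limits N) computeKMax σ (3 * (limits N).cell ^ 2 + 22 * (limits N).cell + 24) Q := by
  set T := intComplexity (σ.reg n - 1) with hT
  have hTL : T ≤ (limits N).cell := hf ▸ le_cell_of_table hσ ha (by omega)
  have hv := two_mul_cell_le N
  have hE : 2 * maxVal T ≤ (limits N).val :=
    (Nat.mul_le_mul_left 2 (maxVal_intComplexity_le_sq (by omega))).trans
      (two_mul_sq_le (by omega))
  -- Because E(0) = 1, this says that t = 0 passes the test: the search stops there at the latest
  -- and t - 1 is never negative.
  have hnT : σ.reg n ≤ maxVal T + 1 := by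
    have := le_maxVal_intComplexity (n := σ.reg n - 1) (by omega)
    rw [← hT] at this
    omega
  apply Runs.of_le
  · refine Runs.sub hσ ?_ (fun h₁ => Runs.load (v := T) h₁ ?_ ?_ fun h₂ => Runs.div h₂ ?_ ?_
      fun h₃ => Runs.block_cons (T := 3 * T + 14) (T' := (T * (3 * T + 16) + 1) + (3 * T + 6 + 0))
      (Runs.of_le (runs_sumOfE h₃ ?_ ?_ fun τ hτ harr hs ht htg hn' hnM hlm =>
        Runs.block_cons ?_) ?_)) ?_
    · simp; omega
    · simpa [ha, hf] using table_getElem? f (i := σ.reg n - 1) (by omega)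
    · omega
    · simp
    · simp; omega
    · simp; omega
    · simpa using hE
    · simp at hs ht htg hn' hnM hlm harr
      refine Runs.whileLt_const (c := 3 * T + 15)
        (Inv := fun i τ => τ.arr = σ.arr ∧ τ.reg t = i ∧ 2 * i ≤ T ∧ τ.reg target = T ∧
          τ.reg s = maxVal i + maxVal (T - i) ∧ (∀ k, i < k → 2 * k ≤ T →
            maxVal k + maxVal (T - k) < σ.reg n) ∧ τ.reg n = σ.reg n ∧
          τ.reg nMax = σ.reg nMax ∧ τ.reg lim = σ.reg lim) ?_ (T / 2) hτ ?_ ?_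
      · rintro i υ hυ ⟨harr, hi, hiT, htg, hs, hmax, hn', hnM, hlm⟩
        by_cases hlt : υ.reg s < υ.reg n
        · right
          have hi0 : i ≠ 0 := by
            rintro rfl
            simp only [maxVal, Nat.sub_zero] at hs
            omega
          refine ⟨hlt, i - 1, by omega, ?_⟩
          apply Runs.of_le
          · refine Runs.sub hυ ?_ (fun h₁ => Runs.block_cons (T := 3 * T + 14) (T' := 0)
              (Runs.of_le (runs_sumOfE h₁ ?_ ?_ fun ω hω harr' hs' ht' htg' hn'' hnM' hlm' =>
              Runs.block_nil hω ?_) ?_)) ?_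
            · simp; omega
            · simp; omega
            · simpa [htg] using hE
            · simp at hs' ht' htg' hn'' hnM' hlm' harr'
              refine ⟨harr'.trans harr, by omega, by omega, by omega, by rw [hs', hi, htg], ?_,
                by omega, by omega, by omega⟩
              intro k hk hkT
              rcases (show i ≤ k by omega).eq_or_lt with rfl | h
              · omega
              · exact hmax k h hkT
            · simp [htg]
            · exact hυ.reg_le t
          · omega
        · left
          refine ⟨hlt, ?_⟩
          have hmt : maxVal (υ.reg t) ≤ maxVal T := maxVal_mono (by omega)
          refine Runs.block_cons (Runs.of_le (runs_computeE hυ (by decide) (by omega)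
            fun ω hω harr' hk hfr => Runs.block_nil hω (hQ ω hω ?_ ?_ ?_ ?_ ⟨i, ⟨?_, ?_, ?_⟩, ?_⟩))
            (by omega))
          · rw [hfr _ (by decide) (by decide) (by decide), hnM]
          · rw [hfr _ (by decide) (by decide) (by decide), hlm]
          · rw [hfr _ (by decide) (by decide) (by decide), hn']
          · rw [harr', harr]
          · exact hiT
          · change σ.reg n ≤ maxVal i + maxVal (T - i)
            omega
          · exact hmax
          · rw [hk, hi]
      · refine ⟨harr, ht, by omega, htg, hs, fun k hk hk' => by omega, hn', hnM, hlm⟩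
      · have : T / 2 * (3 * T + 15 + 1) ≤ T * (3 * T + 16) :=
          Nat.mul_le_mul (Nat.div_le_self _ _) (by omega)
        omega
    · simp
    · exact hσ.reg_le n
  · nlinarith

theorem runs_testSums {K : ℕ} (hσ : σ.Within (limits N)) (ha : σ.arr = table N f)
    (hN : σ.reg n ≤ N) (hK : σ.reg kMax = K) (hKn : K < σ.reg n)
    (hf : ∀ j, 1 ≤ j → j < σ.reg n → f j = intComplexity j)
    (hlow : intComplexity (σ.reg n) ≤ f (σ.reg n))
    (hQ : ∀ τ v, τ.Within (limits N) → τ.reg nMax = σ.reg nMax → τ.reg lim = σ.reg lim →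
      τ.reg n = σ.reg n → τ.arr = table N (Function.update f (σ.reg n) v) →
      intComplexity (σ.reg n) ≤ v → v ≤ f (σ.reg n) →
      (∀ m, 6 ≤ m → m ≤ K → v ≤ intComplexity m + intComplexity (σ.reg n - m)) → Q τ) :
    Runs (limits N) testSums σ (9 * K + 3) Q := by
  have hv := two_mul_succ_le_val N
  have hv' := two_mul_cell_le N
  apply Runs.of_le
  · refine Runs.add hσ ?_ fun h₁ => Runs.move h₁ ?_ fun h₂ => Runs.block_cons (T := 9 * K + 1)
      (T' := 0) ?_
    · simp; omega
    · exact le_trans (by norm_num) (two_mul_sq_le (n := 2) (N := N) (by omega))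
    -- Only entry n changes; v is its current value. The rounds m = 6, …, K number K - 5, truncated
    -- to 0 for small K, which the alternative i = 0 accommodates.
    refine Runs.whileLt_const (c := 8)
      (Inv := fun i τ => ∃ v, τ.arr = table N (Function.update f (σ.reg n) v) ∧
        intComplexity (σ.reg n) ≤ v ∧ v ≤ f (σ.reg n) ∧ 6 ≤ τ.reg m ∧ K + 1 ≤ i + τ.reg m ∧
        (i = 0 ∨ τ.reg m + i ≤ K + 1) ∧ τ.reg bound = K + 1 ∧
        (∀ k, 6 ≤ k → k < τ.reg m → v ≤ intComplexity k + intComplexity (σ.reg n - k)) ∧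
        τ.reg n = σ.reg n ∧ τ.reg nMax = σ.reg nMax ∧ τ.reg lim = σ.reg lim) ?_ (K - 5) h₂ ?_ ?_
    · rintro i τ hτ ⟨v, harr, hv₁, hv₂, h6, hi, hi', hb, hk, hn', hnM, hlm⟩
      by_cases hlt : τ.reg m < τ.reg bound
      · right
        refine ⟨hlt, i - 1, by omega, ?_⟩
        have hupd : ∀ j, 1 ≤ j → j < σ.reg n →
            Function.update f (σ.reg n) v j = intComplexity j := fun j h1 h2 => by
          rw [Function.update_of_ne h2.ne, hf j h1 h2]
        have hm := hupd (τ.reg m) (by omega) (by omega)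
        have hnm := hupd (σ.reg n - τ.reg m) (by omega) (by omega)
        have hc₁ := le_cell_of_table (i := τ.reg m) hτ harr (by omega)
        have hc₂ := le_cell_of_table (i := σ.reg n - τ.reg m) hτ harr (by omega)
        have hc₃ := le_cell_of_table (i := σ.reg n) hτ harr hN
        simp only [Function.update_self] at hc₃
        rw [hm] at hc₁
        rw [hnm] at hc₂
        refine Runs.load (v := intComplexity (τ.reg m)) hτ ?_ ?_ fun h₁ => Runs.sub h₁ ?_ (fun h₂ =>
          Runs.load (v := intComplexity (σ.reg n - τ.reg m)) h₂ ?_ ?_ fun h₃ => Runs.add h₃ ?_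
          fun h₄ => Runs.load (v := v) h₄ ?_ ?_ fun h₅ => Runs.block_cons (T := 2) (T' := 1)
          (runs_relax (N := N) (f := Function.update f (σ.reg n) v) h₅ ?_ ?_ ?_
          fun υ hυ hreg harr' => Runs.add hυ ?_ fun h₆ => Runs.block_nil h₆ ?_)) ?_
        · simp only [val_R, harr, table_getElem? _ (show τ.reg m ≤ N by omega), hm]
        · omega
        · simp [hn']; omega
        · simp [hn', harr, table_getElem? _ (show σ.reg n - τ.reg m ≤ N by omega), hnm]
        · omega
        · simp; omega
        · simp [hn', harr, table_getElem? _ hN]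
        · omega
        · simpa using harr
        · simp [hn', hN]
        · simp [hn']
        · simp [hreg]; omega
        · have hum : υ.reg m = τ.reg m := by simp [hreg]
          simp only [put_reg, put_arr, hreg, harr']
          simp [hn', hnM, hlm, hb, hum]
          refine ⟨min v (intComplexity (τ.reg m) + intComplexity (σ.reg n - τ.reg m)), rfl, ?_, ?_,
            by omega, by omega, by omega, ?_⟩
          · refine le_min hv₁ ?_
            have := intComplexity_add_le (a := τ.reg m) (b := σ.reg n - τ.reg m)
              (by omega) (by omega)
            rwa [Nat.add_sub_cancel' (by omega)] at this
          · exact (min_le_left _ _).trans hv₂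
          · intro k h6k hkm
            rcases hkm.eq_or_lt with rfl | h
            · exact min_le_right _ _
            · exact (min_le_left _ _).trans (hk k h6k h)
        · simpa using hτ.reg_le n
      · left
        exact ⟨hlt, Runs.block_nil hτ (hQ τ v hτ hnM hlm hn' harr hv₁ hv₂
          fun k h6k hkK => hk k h6k (by omega))⟩
    · refine ⟨f (σ.reg n), by simpa using ha, hlow, le_rfl, ?_⟩
      simp [hK]
      refine ⟨by omega, by omega, ?_⟩
      intro k h1 h2
      omega
    · omega
  · omega

/-- The content of the array after the numbers below `n` have been treated. -/
structure Invariant (N n : ℕ) (f : ℕ → ℕ) : Prop where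
  eq_of_lt : ∀ j, 1 ≤ j → j < n → f j = intComplexity j
  le_apply : ∀ j, 1 ≤ j → j ≤ N → intComplexity j ≤ f j
  apply_mul_le : ∀ a b, 2 ≤ a → a ≤ b → b < n → a * b ≤ N →
    f (a * b) ≤ intComplexity a + intComplexity b

/-- A product is tested in the round of its larger factor, so multipliers up to min(n, ⌊N/n⌋)
suffice. -/
theorem runs_testProducts (hσ : σ.Within (limits N)) (ha : σ.arr = table N f)
    (hnM : σ.reg nMax = N) (hn : 2 ≤ σ.reg n) (hN : σ.reg n ≤ N)
    (hf : ∀ j, 1 ≤ j → j ≤ σ.reg n → f j = intComplexity j)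
    (hlow : ∀ j, 1 ≤ j → j ≤ N → intComplexity j ≤ f j)
    (hmul : ∀ a b, 2 ≤ a → a ≤ b → b < σ.reg n → a * b ≤ N →
      f (a * b) ≤ intComplexity a + intComplexity b)
    (hQ : ∀ τ g, τ.Within (limits N) → τ.reg nMax = N → τ.reg lim = σ.reg lim →
      τ.reg n = σ.reg n → τ.arr = table N g → Invariant N (σ.reg n + 1) g → Q τ) :
    Runs (limits N) testProducts σ (9 * (N / σ.reg n) + 15) Q := by
  have hv := two_mul_succ_le_val N
  have hv' := two_mul_cell_le N
  set M := min (σ.reg n) (N / σ.reg n) with hM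
  have hNn : N / σ.reg n ≤ N := Nat.div_le_self _ _
  apply Runs.of_le
  · refine Runs.div hσ ?_ ?_ fun h₁ => Runs.block_cons (T := 2)
      (T' := 1 + (1 + ((9 * M + 1) + 0))) ?_
    · simp; omega
    · exact hσ.reg_le nMax
    -- Both branches that compute the minimum continue in the same way, so the continuation is
    -- treated once.
    have main : ∀ τ, τ.Within (limits N) → τ.arr = σ.arr → τ.reg bound = M →
        τ.reg nMax = N → τ.reg lim = σ.reg lim → τ.reg n = σ.reg n →
        Runs (limits N) (block [add bound (R bound) (K 1), move k (K 2),
          .whileLt (R k) (R bound) (block [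
            load a (R k),
            load c (R n),
            add a (R a) (R c),
            mul idx (R k) (R n),
            load c (R idx),
            .ifLt (R a) (R c) (store (R idx) (R a)) .skip,
            add k (R k) (K 1)])]) τ (1 + (1 + ((9 * M + 1) + 0))) Q := by
      intro τ hτ harr hb hnM hlm hn'
      refine Runs.add hτ ?_ fun h₁ => Runs.move h₁ ?_ fun h₂ => Runs.block_cons ?_
      · simp; omega
      · exact two_le_val N
      refine Runs.whileLt_const (c := 8)
        (Inv := fun i τ => ∃ g, τ.arr = table N g ∧ 2 ≤ τ.reg k ∧ M + 1 ≤ i + τ.reg k ∧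
          (i = 0 ∨ τ.reg k + i ≤ M + 1) ∧ τ.reg bound = M + 1 ∧
          (∀ j, 1 ≤ j → j ≤ σ.reg n → g j = intComplexity j) ∧
          (∀ j, 1 ≤ j → j ≤ N → intComplexity j ≤ g j) ∧
          (∀ j, g j ≤ f j) ∧
          (∀ a, 2 ≤ a → a < τ.reg k →
            g (a * σ.reg n) ≤ intComplexity a + intComplexity (σ.reg n)) ∧
          τ.reg n = σ.reg n ∧ τ.reg nMax = N ∧ τ.reg lim = σ.reg lim) ?_ (M - 1) h₂ ?_ ?_
      · rintro i τ hτ ⟨g, harr, h2, hi, hi', hb, hg, hglow, hgf, hgk, hn', hnM, hlm⟩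
        by_cases hlt : τ.reg k < τ.reg bound
        · right
          refine ⟨hlt, i - 1, by omega, ?_⟩
          have hkn : τ.reg k ≤ σ.reg n := by omega
          have hidx : τ.reg k * σ.reg n ≤ N :=
            (Nat.le_div_iff_mul_le (by omega)).1 (by omega)
          -- As k ≥ 2, the entry written lies beyond n and the final entries stay untouched.
          have hidx' : σ.reg n < τ.reg k * σ.reg n := by nlinarith
          have hk₁ := hg (τ.reg k) (by omega) hkn
          have hn₁ := hg (σ.reg n) (by omega) le_rfl
          have hc₁ := le_cell_of_table (i := τ.reg k) hτ harr (by omega)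
          have hc₂ := le_cell_of_table (i := σ.reg n) hτ harr hN
          have hc₃ := le_cell_of_table (i := τ.reg k * σ.reg n) hτ harr hidx
          refine Runs.load (v := g (τ.reg k)) hτ ?_ ?_ fun h₁ => Runs.load (v := g (σ.reg n)) h₁
            ?_ ?_ fun h₂ => Runs.add h₂ ?_ fun h₃ => Runs.mul h₃ ?_ fun h₄ =>
            Runs.load (v := g (τ.reg k * σ.reg n)) h₄ ?_ ?_ fun h₅ =>
            Runs.block_cons (T := 2) (T' := 1)
            (runs_relax (N := N) (f := g) h₅ ?_ ?_ ?_
            fun υ hυ hreg harr' => Runs.add hυ ?_ fun h₆ => Runs.block_nil h₆ ?_)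
          · simp only [val_R, harr, table_getElem? _ (show τ.reg k ≤ N by omega)]
          · omega
          · simp [hn', harr, table_getElem? _ hN]
          · omega
          · simp; omega
          · simp [hn']; omega
          · simp [hn', harr, table_getElem? _ hidx]
          · omega
          · simpa using harr
          · simpa [hn'] using hidx
          · simp [hn']
          · simp [hreg]; omega
          · have huk : υ.reg k = τ.reg k := by simp [hreg]
            have hun : υ.reg n = σ.reg n := by simp [hreg, hn']
            have hub : υ.reg bound = M + 1 := by simp [hreg, hb]
            have hum : υ.reg nMax = N := by simp [hreg, hnM]
            have hul : υ.reg lim = σ.reg lim := by simp [hreg, hlm]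
            simp [hn'] at harr'
            refine ⟨_, harr', ?_⟩
            simp [huk, hun, hub, hum, hul]
            refine ⟨by omega, by omega, by omega, ?_, ?_, ?_, ?_⟩
            · intro j h1 hj
              rw [Function.update_of_ne (by omega), hg j h1 hj]
            · intro j h1 hj
              rcases eq_or_ne j (τ.reg k * σ.reg n) with rfl | hne
              · rw [Function.update_self, hk₁, hn₁]
                exact le_min (hglow _ h1 hj) (intComplexity_mul_le (by omega) (by omega))
              · rw [Function.update_of_ne hne]
                exact hglow j h1 hj
            · intro j
              rcases eq_or_ne j (τ.reg k * σ.reg n) with rfl | hne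
              · rw [Function.update_self]
                exact (min_le_left _ _).trans (hgf _)
              · rw [Function.update_of_ne hne]
                exact hgf j
            · intro a h2a hak
              rcases eq_or_ne a (τ.reg k) with rfl | hne
              · rw [Function.update_self, hk₁, hn₁]
                exact min_le_right _ _
              · rw [Function.update_of_ne fun h => hne (Nat.eq_of_mul_eq_mul_right (by omega) h)]
                exact hgk a h2a (by omega)
        · left
          refine ⟨hlt, Runs.block_nil hτ (hQ τ g hτ hnM hlm hn' harr
            ⟨fun j h1 hj => hg j h1 (by omega), hglow, fun a b h2a hab hb' hN' => ?_⟩)⟩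
          rcases (Nat.le_of_lt_succ hb').eq_or_lt with rfl | h
          · refine hgk a h2a ?_
            have := (Nat.le_div_iff_mul_le (by omega)).2 hN'
            omega
          · exact (hgf _).trans (hmul a b h2a hab h hN')
      · refine ⟨f, by simp [harr, ha], ?_⟩
        simp [hn', hnM, hlm, hb]
        refine ⟨by omega, by omega, hf, hlow, fun a h1 h2 => by omega⟩
      · omega
    refine Runs.ifLt (T := 1) h₁ (fun h => ?_) fun h => ?_
    · have hw := h₁.put bound (h₁.reg_le n)
      refine Runs.instr h₁ rfl hw le_rfl (main _ hw ?_ ?_ ?_ ?_ ?_)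
      all_goals simp [hnM] at h ⊢
      omega
    · refine Runs.skip h₁ (main _ h₁ ?_ ?_ ?_ ?_ ?_)
      all_goals simp [hnM] at h ⊢
      omega
  · omega

theorem Invariant.initial (N : ℕ) :
    Invariant N 2 (Function.update (fun _ => (N ^ 3).size) 1 1) where
  eq_of_lt j h1 h2 := by
    obtain rfl : j = 1 := by omega
    rw [Function.update_self, intComplexity_one]
  le_apply j h1 hj := by
    rcases eq_or_ne j 1 with rfl | h
    · rw [Function.update_self, intComplexity_one]
    · rw [Function.update_of_ne h]
      exact intComplexity_le_size h1 hj
  apply_mul_le a b ha hab hb := by omega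

/-- A bound for the number of steps in one round of the main loop. -/
noncomputable def roundCost (N n : ℕ) : ℕ :=
  3 * (limits N).cell ^ 2 + 22 * (limits N).cell +
    9 * (2 * maxVal (intComplexity (n - 1)) / n) + 9 * (N / n) + 49

theorem runs_round (hσ : σ.Within (limits N)) (ha : σ.arr = table N f) (hf : Invariant N (σ.reg n) f)
    (hnM : σ.reg nMax = N) (hn : 2 ≤ σ.reg n) (hN : σ.reg n ≤ N)
    (hQ : ∀ τ g, τ.Within (limits N) → τ.reg nMax = N → τ.reg lim = σ.reg lim →
      τ.reg n = σ.reg n + 1 → τ.arr = table N g → Invariant N (σ.reg n + 1) g → Q τ) :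
    Runs (limits N) (block [usualBestValue, computeKMax, testSums, testProducts,
      add n (R n) (K 1)]) σ (roundCost N (σ.reg n)) Q := by
  have hpred := hf.eq_of_lt (σ.reg n - 1) (by omega) (by omega)
  have hv := two_mul_succ_le_val N
  apply Runs.of_le
  · refine Runs.block_cons (T' := _ + (9 * (2 * maxVal (intComplexity (σ.reg n - 1)) / σ.reg n) + 3
      + (9 * (N / σ.reg n) + 15 + 1))) (runs_usualBestValue hσ ha (by omega) hN
      fun τ₁ h₁ hnM₁ hlm₁ hn₁ ha₁ => Runs.block_cons (runs_computeKMax h₁ ha₁ (by omega) (by omega)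
      ?_ fun τ₂ h₂ hnM₂ hlm₂ hn₂ ha₂ ⟨w, ht, hk⟩ => Runs.block_cons ?_))
    · rw [hn₁, Function.update_of_ne (by omega), hpred]
    rw [hn₁] at ht hn₂
    have hlt := ht.maxVal_lt hn
    have hcost := ht.maxVal_le_div hn
    refine Runs.of_le (runs_testSums h₂ (ha₂.trans ha₁) (by omega) hk (by omega) ?_ ?_
      fun τ₃ v h₃ hnM₃ hlm₃ hn₃ ha₃ hv₁ hv₂ hv₃ => Runs.block_cons ?_) (by omega)
    · intro j h1 hj
      rw [hn₂] at hj
      rw [Function.update_of_ne hj.ne, hf.eq_of_lt j h1 hj]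
    · rw [hn₂, Function.update_self, hpred]
      refine le_min (hf.le_apply _ (by omega) hN) ?_
      have := intComplexity_succ_le (n := σ.reg n - 1) (by omega)
      rwa [Nat.sub_add_cancel (by omega)] at this
    rw [hn₂] at hv₁ hv₂ hv₃ hn₃ ha₃
    rw [Function.update_self, hpred] at hv₂
    rw [Function.update_idem] at ha₃
    -- The three tests are complete here: predecessor, sums, and the products recorded in earlier
    -- rounds.
    have hfin : v = intComplexity (σ.reg n) := by
      refine eq_intComplexity_of_tests hn ht hv₁ (hv₂.trans (min_le_right _ _)) hv₃ ?_
      intro a b h2 hab hmul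
      have := hf.apply_mul_le a b h2 hab (by nlinarith) (by omega)
      rw [hmul] at this
      exact (hv₂.trans (min_le_left _ _)).trans this
    subst hfin
    rw [← hn₃]
    refine runs_testProducts h₃ ha₃ (by omega) (by omega) (by omega) ?_ ?_ ?_
      fun τ₄ g h₄ hnM₄ hlm₄ hn₄ ha₄ hg => Runs.add h₄ ?_ fun h₅ =>
        Runs.block_nil h₅ (hQ _ g h₅ ?_ ?_ ?_ ?_ ?_)
    · intro j h1 hj
      rcases eq_or_ne j (σ.reg n) with rfl | hne
      · rw [Function.update_self]
      · rw [Function.update_of_ne hne, hf.eq_of_lt j h1 (by omega)]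
    · intro j h1 hj
      rcases eq_or_ne j (σ.reg n) with rfl | hne
      · rw [Function.update_self]
      · rw [Function.update_of_ne hne]
        exact hf.le_apply j h1 hj
    · intro a b h2 hab hb hN'
      rcases eq_or_ne (a * b) (σ.reg n) with heq | hne
      · rw [heq, Function.update_self, ← heq]
        exact intComplexity_mul_le (by omega) (by omega)
      · rw [Function.update_of_ne hne]
        exact hf.apply_mul_le a b h2 hab (by omega) hN'
    · simp; omega
    · simpa using hnM₄
    · simp; omega
    · simp; omega
    · simpa using ha₄
    · rwa [hn₃] at hg
  · simp only [roundCost]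
    omega

theorem runs_program (hN : 1 ≤ N) :
    Runs (limits N) program (input N) (3 * (N ^ 3).size + 3 * N + 13 +
      ∑ n ∈ Finset.Icc 2 N, (roundCost N n + 1)) (fun τ => ∀ n, 1 ≤ n → n ≤ N →
        τ.arr[n]? = some (intComplexity n)) := by
  apply Runs.of_le
  · refine Runs.block_cons (runs_initCompl hN fun τ hτ hnM hlm ha => Runs.move hτ (two_le_val N)
      fun h₁ => Runs.block_cons
      (T := ∑ j ∈ Finset.range (N - 1), (roundCost N (N - j) + 1) + 1) (T' := 0) ?_)
    -- With j rounds left after the current one, the current number is N - j.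
    refine Runs.whileLt (cost := fun j => roundCost N (N - j)) (Inv := fun i τ => ∃ f,
      τ.arr = table N f ∧ τ.reg nMax = N ∧ τ.reg lim = N + 1 ∧ 2 ≤ τ.reg n ∧ τ.reg n + i = N + 1 ∧
      Invariant N (τ.reg n) f) ?_ (N - 1) h₁ ?_
    · rintro i σ hσ ⟨f, ha, hnM, hlm, h2, hi, hf⟩
      by_cases hlt : σ.reg n < σ.reg lim
      · right
        refine ⟨hlt, i - 1, by omega, ?_⟩
        rw [show N - (i - 1) = σ.reg n by omega]
        refine runs_round hσ ha hf hnM h2 (by omega) fun υ g hυ hnM' hlm' hn' ha' hg =>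
          ⟨g, ha', hnM', by omega, by omega, by omega, by rwa [hn']⟩
      · left
        refine ⟨hlt, Runs.block_nil hσ fun j h1 hj => ?_⟩
        rw [ha, table_getElem? f hj, hf.eq_of_lt j h1 (by omega)]
    · refine ⟨_, by simpa using ha, by simpa using hnM, by simpa using hlm, by simp, ?_, ?_⟩
      · simp; omega
      · simpa using Invariant.initial N
  · have : ∑ j ∈ Finset.range (N - 1), (roundCost N (N - j) + 1) =
        ∑ n ∈ Finset.Icc 2 N, (roundCost N n + 1) := by
      refine Finset.sum_nbij' (fun j => N - j) (fun n => N - n) ?_ ?_ ?_ ?_ ?_ <;>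
        simp <;> intros <;> omega
    omega

end TimeImproved

/-! ### The mean size of `3 ^ (‖n‖ / 3) / n` -/

/-- The weight `3 ^ (‖n‖ / 3) / n`. -/
noncomputable def complexityWeight (n : ℕ) : ℝ := (3 : ℝ) ^ ((intComplexity n : ℝ) / 3) / n

theorem complexityWeight_nonneg (n : ℕ) : 0 ≤ complexityWeight n := by
  unfold complexityWeight; positivity

/-- The factor by which a division of `n` by `p` with remainder `d` changes the weight, times
`p ^ (-1.23)`. -/
noncomputable def stepWeight (p d : ℕ) : ℝ :=
  (3 : ℝ) ^ (((p + d : ℕ) : ℝ) / 3) * (p : ℝ) ^ (-(2.23 : ℝ))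

/-- The product of the step weights when `r` is divided by the members of a list in turn. -/
noncomputable def chainWeight : List ℕ → ℕ → ℝ
  | [], _ => 1
  | p :: ps, r => stepWeight p (r % p) * chainWeight ps (r / p)

theorem stepWeight_nonneg (p d : ℕ) : 0 ≤ stepWeight p d := by
  unfold stepWeight; positivity

theorem chainWeight_nonneg (ps : List ℕ) (r : ℕ) : 0 ≤ chainWeight ps r := by
  induction ps generalizing r with
  | nil => simp [chainWeight]
  | cons p ps ih => exact mul_nonneg (stepWeight_nonneg _ _) (ih _)

theorem complexityWeight_le_div {p n : ℕ} (hp : 1 ≤ p) (hn : p ≤ n) :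
    complexityWeight n ≤ stepWeight p (n % p) * (p : ℝ) ^ (1.23 : ℝ) * complexityWeight (n / p) := by
  have hq : 1 ≤ n / p := (Nat.one_le_div_iff (by omega)).2 hn
  have hp0 : (0 : ℝ) < p := by exact_mod_cast hp
  have hq0 : (0 : ℝ) < (n / p : ℕ) := by exact_mod_cast hq
  have hpow : (p : ℝ) ^ (-(2.23 : ℝ)) * (p : ℝ) ^ (1.23 : ℝ) = (p : ℝ)⁻¹ := by
    rw [← Real.rpow_add hp0, ← Real.rpow_neg_one]; norm_num
  have hle : (p : ℝ) * (n / p : ℕ) ≤ n := by exact_mod_cast Nat.mul_div_le n p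
  have hexp : (3 : ℝ) ^ ((intComplexity n : ℝ) / 3) ≤
      (3 : ℝ) ^ (((p + n % p : ℕ) : ℝ) / 3) * (3 : ℝ) ^ ((intComplexity (n / p) : ℝ) / 3) := by
    rw [← Real.rpow_add (by norm_num)]
    refine Real.rpow_le_rpow_of_exponent_le (by norm_num) ?_
    have : (intComplexity n : ℝ) ≤ intComplexity (n / p) + (p + n % p : ℕ) := by
      exact_mod_cast intComplexity_le_div hp hn
    linarith
  calc complexityWeight n
      ≤ ((3 : ℝ) ^ (((p + n % p : ℕ) : ℝ) / 3) * (3 : ℝ) ^ ((intComplexity (n / p) : ℝ) / 3)) /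
          (p * (n / p : ℕ)) := by
        unfold complexityWeight
        gcongr
    _ = (3 : ℝ) ^ (((p + n % p : ℕ) : ℝ) / 3) * (p : ℝ)⁻¹ * complexityWeight (n / p) := by
        unfold complexityWeight
        field_simp
    _ = _ := by rw [stepWeight, mul_assoc (_ ^ _) (_ ^ _) (_ ^ _), hpow]

/-- The successive remainders are the mixed radix digits of n, hence determined by n modulo the
product: the bound is uniform on a residue class. -/
theorem complexityWeight_le_chain {ps : List ℕ} (hps : ∀ p ∈ ps, 1 ≤ p) {n : ℕ}
    (hn : ps.prod ≤ n) :
    complexityWeight n ≤ chainWeight ps (n % ps.prod) * (ps.prod : ℝ) ^ (1.23 : ℝ) *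
      complexityWeight (n / ps.prod) := by
  induction ps generalizing n with
  | nil => simp [chainWeight]
  | cons p ps ih =>
    have hp : 1 ≤ p := hps p (by simp)
    have hps' : ∀ q ∈ ps, 1 ≤ q := fun q hq => hps q (by simp [hq])
    have hprod : 1 ≤ ps.prod := List.prod_pos fun q hq => hps' q hq
    rw [List.prod_cons] at hn ⊢
    have hpn : p ≤ n := (Nat.le_mul_of_pos_right p hprod).trans hn
    have hq : ps.prod ≤ n / p := (Nat.le_div_iff_mul_le (by omega)).2 (by rwa [mul_comm])
    have h := ih hps' hq
    rw [Nat.div_div_eq_div_mul] at h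
    calc complexityWeight n
        ≤ stepWeight p (n % p) * (p : ℝ) ^ (1.23 : ℝ) * complexityWeight (n / p) :=
          complexityWeight_le_div hp hpn
      _ ≤ stepWeight p (n % p) * (p : ℝ) ^ (1.23 : ℝ) * (chainWeight ps (n / p % ps.prod) *
            (ps.prod : ℝ) ^ (1.23 : ℝ) * complexityWeight (n / (p * ps.prod))) := by
          refine mul_le_mul_of_nonneg_left h ?_
          have := stepWeight_nonneg p (n % p)
          positivity
      _ = _ := by
          rw [chainWeight, Nat.mod_mul_right_mod, Nat.mod_mul_right_div_self, Nat.cast_mul,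
            Real.mul_rpow (by positivity) (by positivity)]
          ring

/-- The sum of the weights of the integers `1, …, N`. -/
noncomputable def weightSum (N : ℕ) : ℝ := ∑ n ∈ Finset.Icc 1 N, complexityWeight n

/-- The sum of the weights of the integers `1, …, N` in a residue class. -/
noncomputable def classSum (b r N : ℕ) : ℝ :=
  ∑ n ∈ Finset.Icc 1 N, if n % b = r then complexityWeight n else 0

theorem classSum_one (N : ℕ) : classSum 1 0 N = weightSum N := by
  simp [classSum, weightSum, Nat.mod_one]

/-- Equality holds for r < b; the inequality suffices and needs no condition on r. -/
theorem classSum_bisect (b r N : ℕ) :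
    classSum b r N ≤ classSum (2 * b) r N + classSum (2 * b) (r + b) N := by
  simp only [classSum, ← Finset.sum_add_distrib]
  refine Finset.sum_le_sum fun n _ => ?_
  have h0 := complexityWeight_nonneg n
  have hm : n % (2 * b) = n % b + b * (n / b % 2) := by rw [mul_comm 2 b, Nat.mod_mul]
  by_cases h : n % b = r
  · have : n % (2 * b) = r ∨ n % (2 * b) = r + b := by
      rcases Nat.mod_two_eq_zero_or_one (n / b) with h' | h' <;> rw [h'] at hm <;> omega
    rw [if_pos h]
    rcases this with h' | h' <;> rw [if_pos h'] <;> split_ifs <;> linarith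
  · rw [if_neg h]
    split_ifs <;> linarith

theorem classSum_trisect (b r N : ℕ) :
    classSum b r N ≤ classSum (3 * b) r N + classSum (3 * b) (r + b) N +
      classSum (3 * b) (r + 2 * b) N := by
  simp only [classSum, ← Finset.sum_add_distrib]
  refine Finset.sum_le_sum fun n _ => ?_
  have h0 := complexityWeight_nonneg n
  have hm : n % (3 * b) = n % b + b * (n / b % 3) := by rw [mul_comm 3 b, Nat.mod_mul]
  by_cases h : n % b = r
  · have : n % (3 * b) = r ∨ n % (3 * b) = r + b ∨ n % (3 * b) = r + 2 * b := by
      have h3 : n / b % 3 < 3 := Nat.mod_lt _ (by norm_num)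
      generalize n / b % 3 = c at h3 hm
      interval_cases c <;> omega
    rw [if_pos h]
    rcases this with h' | h' | h' <;> rw [if_pos h'] <;> split_ifs <;> linarith
  · rw [if_neg h]
    split_ifs <;> linarith

/-- The members up to b go into a constant. On the others n ↦ ⌊n/b⌋ is injective, since the residue
is fixed, with values in 1, …, ⌊N/b⌋. -/
theorem classSum_le_chain {ps : List ℕ} (hps : ∀ p ∈ ps, 1 ≤ p) (r N : ℕ) :
    classSum ps.prod r N ≤ weightSum ps.prod +
      chainWeight ps r * (ps.prod : ℝ) ^ (1.23 : ℝ) * weightSum (N / ps.prod) := by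
  set b := ps.prod with hb
  have hbpos : 1 ≤ b := List.prod_pos fun q hq => hps q hq
  set W := chainWeight ps r * (b : ℝ) ^ (1.23 : ℝ) with hW
  have hW0 : 0 ≤ W := mul_nonneg (chainWeight_nonneg _ _) (by positivity)
  have hpt : ∀ n ∈ Finset.Icc 1 N, (if n % b = r then complexityWeight n else 0) ≤
      (if n ≤ b then complexityWeight n else 0) +
      W * (if n % b = r ∧ b ≤ n then complexityWeight (n / b) else 0) := by
    intro n _
    have h0 := complexityWeight_nonneg n
    have h1 := complexityWeight_nonneg (n / b)
    by_cases h : n % b = r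
    · rcases le_total b n with hbn | hbn
      · have hc := complexityWeight_le_chain hps (n := n) (hb ▸ hbn)
        rw [← hb, h, ← hW] at hc
        rw [if_pos h, if_pos (show n % b = r ∧ b ≤ n from ⟨h, hbn⟩)]
        split_ifs <;> linarith
      · rw [if_pos h, if_pos hbn]
        have : 0 ≤ W * (if n % b = r ∧ b ≤ n then complexityWeight (n / b) else 0) := by
          split_ifs <;> positivity
        linarith
    · rw [if_neg h]
      split_ifs <;> positivity
  refine (Finset.sum_le_sum hpt).trans ?_
  rw [Finset.sum_add_distrib, ← Finset.mul_sum, ← Finset.sum_filter, ← Finset.sum_filter]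
  refine add_le_add ?_ (mul_le_mul_of_nonneg_left ?_ hW0)
  · refine Finset.sum_le_sum_of_subset_of_nonneg (fun n hn => ?_) fun n _ _ =>
      complexityWeight_nonneg n
    simp only [Finset.mem_filter, Finset.mem_Icc] at hn ⊢
    omega
  · rw [← Finset.sum_image (g := fun n => n / b) (f := complexityWeight)]
    · refine Finset.sum_le_sum_of_subset_of_nonneg (fun q hq => ?_) fun n _ _ =>
        complexityWeight_nonneg n
      simp only [Finset.mem_image, Finset.mem_filter, Finset.mem_Icc] at hq ⊢
      obtain ⟨n, ⟨⟨-, hnN⟩, -, hbn⟩, rfl⟩ := hq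
      exact ⟨(Nat.one_le_div_iff (by omega)).2 hbn, Nat.div_le_div_right hnN⟩
    · intro n hn m hm hnm
      simp only [Finset.coe_filter, Set.mem_ofPred_eq] at hn hm
      have hnm' : n / b = m / b := hnm
      rw [← Nat.div_add_mod n b, ← Nat.div_add_mod m b, hnm', hn.2.1, hm.2.1]

/-! ### A covering system -/

/-- A partition of a residue class into residue classes; a leaf carries the factors by which the
members of the class are to be divided. -/
inductive CoverTree : Type
  | leaf (ps : List ℕ)
  | bisect (x y : CoverTree)
  | trisect (x y z : CoverTree)

namespace CoverTree

/-- The factors at each leaf are `2` or `3` and their product is the modulus of the class. -/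
def valid : CoverTree → ℕ → Bool
  | leaf ps, b => ps.prod == b && ps.all (fun p => p == 2 || p == 3) && !ps.isEmpty
  | bisect x y, b => x.valid (2 * b) && y.valid (2 * b)
  | trisect x y z, b => x.valid (3 * b) && y.valid (3 * b) && z.valid (3 * b)

/-- The sum of the weights of the leaves. -/
noncomputable def weight : CoverTree → ℕ → ℕ → ℝ
  | leaf ps, _, r => chainWeight ps r
  | bisect x y, b, r => x.weight (2 * b) r + y.weight (2 * b) (r + b)
  | trisect x y z, b, r =>
    x.weight (3 * b) r + y.weight (3 * b) (r + b) + z.weight (3 * b) (r + 2 * b)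

/-- B depends on neither N nor C, so C may be chosen after it. The power of each modulus cancels
against that of N/b. -/
theorem classSum_le (t : CoverTree) (b r : ℕ) (ht : t.valid b) :
    ∃ B : ℝ, ∀ (N : ℕ) (C : ℝ), 0 ≤ C → 1 ≤ N → (∀ M < N, weightSum M ≤ C * (M : ℝ) ^ (1.23 : ℝ)) →
      classSum b r N ≤ B + t.weight b r * (C * (N : ℝ) ^ (1.23 : ℝ)) := by
  induction t generalizing b r with
  | leaf ps =>
    simp only [valid, Bool.and_eq_true, beq_iff_eq, List.all_eq_true, Bool.or_eq_true,
      Bool.not_eq_true', List.isEmpty_eq_false_iff] at ht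
    obtain ⟨⟨hb, hps⟩, hne⟩ := ht
    have hps1 : ∀ p ∈ ps, 1 ≤ p := fun p hp => by rcases hps p hp with h | h <;> omega
    have hb2 : 2 ≤ ps.prod := by
      obtain ⟨p, qs, rfl⟩ := List.exists_cons_of_ne_nil hne
      rw [List.prod_cons]
      have h1 : 2 ≤ p := by rcases hps p (by simp) with h | h <;> omega
      have h2 : 1 ≤ qs.prod := List.prod_pos fun q hq => hps1 q (by simp [hq])
      nlinarith
    refine ⟨weightSum ps.prod, fun N C hC hN ih => ?_⟩
    subst hb
    refine (classSum_le_chain hps1 r N).trans (add_le_add le_rfl ?_)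
    have hdiv : ((N / ps.prod : ℕ) : ℝ) ≤ (N : ℝ) / ps.prod := Nat.cast_div_le
    have hpos : (0 : ℝ) < ps.prod := by exact_mod_cast (by omega : 0 < ps.prod)
    have h1 : weightSum (N / ps.prod) ≤ C * ((N : ℝ) / ps.prod) ^ (1.23 : ℝ) :=
      (ih _ (Nat.div_lt_self hN hb2)).trans (mul_le_mul_of_nonneg_left
        (Real.rpow_le_rpow (by positivity) hdiv (by norm_num)) hC)
    rw [Real.div_rpow (by positivity) hpos.le] at h1
    have hpp : (0 : ℝ) < (ps.prod : ℝ) ^ (1.23 : ℝ) := by positivity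
    calc chainWeight ps r * (ps.prod : ℝ) ^ (1.23 : ℝ) * weightSum (N / ps.prod)
        ≤ chainWeight ps r * (ps.prod : ℝ) ^ (1.23 : ℝ) *
          (C * ((N : ℝ) ^ (1.23 : ℝ) / (ps.prod : ℝ) ^ (1.23 : ℝ))) :=
          mul_le_mul_of_nonneg_left h1 (mul_nonneg (chainWeight_nonneg _ _) hpp.le)
      _ = _ := by
          simp only [weight]
          field_simp
  | bisect x y ihx ihy =>
    simp only [valid, Bool.and_eq_true] at ht
    obtain ⟨B₁, h₁⟩ := ihx (2 * b) r ht.1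
    obtain ⟨B₂, h₂⟩ := ihy (2 * b) (r + b) ht.2
    refine ⟨B₁ + B₂, fun N C hC hN ih => (classSum_bisect b r N).trans ?_⟩
    have := h₁ N C hC hN ih
    have := h₂ N C hC hN ih
    simp only [weight]
    linarith
  | trisect x y z ihx ihy ihz =>
    simp only [valid, Bool.and_eq_true] at ht
    obtain ⟨B₁, h₁⟩ := ihx (3 * b) r ht.1.1
    obtain ⟨B₂, h₂⟩ := ihy (3 * b) (r + b) ht.1.2
    obtain ⟨B₃, h₃⟩ := ihz (3 * b) (r + 2 * b) ht.2
    refine ⟨B₁ + B₂ + B₃, fun N C hC hN ih => (classSum_trisect b r N).trans ?_⟩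
    have := h₁ N C hC hN ih
    have := h₂ N C hC hN ih
    have := h₃ N C hC hN ih
    simp only [weight]
    linarith

/-! ### Numerical certification of the covering system. -/

/-- Upper bounds for `10 ^ 6` times the step weights. -/
def stepBound : ℕ → ℕ → ℕ
  | 2, 0 => 443389
  | 2, _ => 639477
  | _, 0 => 258906
  | _, 1 => 373406
  | _, _ => 538545

/-- An upper bound for `10 ^ 9` times the weight of a chain. -/
def chainBound : List ℕ → ℕ → ℕ
  | [], _ => 10 ^ 9
  | p :: ps, r => stepBound p (r % p) * chainBound ps (r / p) / 10 ^ 6 + 1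

/-- An upper bound for `10 ^ 9` times the weight of a tree. -/
def bound : CoverTree → ℕ → ℕ → ℕ
  | leaf ps, _, r => chainBound ps r
  | bisect x y, b, r => x.bound (2 * b) r + y.bound (2 * b) (r + b)
  | trisect x y z, b, r =>
    x.bound (3 * b) r + y.bound (3 * b) (r + b) + z.bound (3 * b) (r + 2 * b)

/-- The 300th power clears all exponents: 300/3 = 100 and 300 · 2.23 = 669. -/
theorem stepWeight_le_of_pow {p d c : ℕ} (hp : 1 ≤ p)
    (h : 3 ^ (100 * (p + d)) * (10 ^ 6) ^ 300 ≤ c ^ 300 * p ^ 669) :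
    stepWeight p d ≤ (c : ℝ) / 10 ^ 6 := by
  have hp0 : (0 : ℝ) < p := by exact_mod_cast hp
  refine le_of_pow_le_pow_left₀ (n := 300) (by norm_num) (by positivity) ?_
  have h3 : ((3 : ℝ) ^ (((p + d : ℕ) : ℝ) / 3)) ^ 300 = 3 ^ (100 * (p + d)) := by
    rw [← Real.rpow_mul_natCast (by norm_num), ← Real.rpow_natCast]
    congr 1
    push_cast; ring
  have hpp : ((p : ℝ) ^ (-(2.23 : ℝ))) ^ 300 = ((p : ℝ) ^ 669)⁻¹ := by
    rw [← Real.rpow_mul_natCast hp0.le, ← Real.rpow_natCast, ← Real.rpow_neg hp0.le]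
    congr 1
    norm_num
  rw [stepWeight, mul_pow, h3, hpp, div_pow, ← div_eq_mul_inv, div_le_div_iff₀ (by positivity)
    (by positivity)]
  exact_mod_cast h

theorem stepWeight_le {p d : ℕ} (hp : p = 2 ∨ p = 3) (hd : d < p) :
    stepWeight p d ≤ (stepBound p d : ℝ) / 10 ^ 6 := by
  refine stepWeight_le_of_pow (by omega) ?_
  rcases hp with rfl | rfl <;> interval_cases d <;> decide +kernel

theorem chainWeight_le {ps : List ℕ} (hps : ∀ p ∈ ps, p = 2 ∨ p = 3) (r : ℕ) :
    chainWeight ps r ≤ (chainBound ps r : ℝ) / 10 ^ 9 := by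
  induction ps generalizing r with
  | nil => norm_num [chainWeight, chainBound]
  | cons p ps ih =>
    have hp := hps p (by simp)
    have h1 := stepWeight_le hp (Nat.mod_lt r (by omega))
    have h2 := ih (fun q hq => hps q (by simp [hq])) (r / p)
    -- The + 1 in `chainBound` compensates for the rounding down.
    have h3 : stepBound p (r % p) * chainBound ps (r / p) ≤
        10 ^ 6 * chainBound (p :: ps) r := by
      rw [chainBound]; omega
    have h3' : (stepBound p (r % p) : ℝ) * chainBound ps (r / p) ≤
        10 ^ 6 * chainBound (p :: ps) r := by exact_mod_cast h3
    rw [chainWeight]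
    refine (mul_le_mul h1 h2 (chainWeight_nonneg _ _) (by positivity)).trans ?_
    rw [div_mul_div_comm, div_le_div_iff₀ (by positivity) (by positivity)]
    linarith

theorem weight_le (t : CoverTree) (b r : ℕ) (ht : t.valid b) :
    t.weight b r ≤ (t.bound b r : ℝ) / 10 ^ 9 := by
  induction t generalizing b r with
  | leaf ps =>
    simp only [valid, Bool.and_eq_true, beq_iff_eq, List.all_eq_true, Bool.or_eq_true] at ht
    exact chainWeight_le ht.1.2 r
  | bisect x y ihx ihy =>
    simp only [valid, Bool.and_eq_true] at ht
    have := ihx (2 * b) r ht.1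
    have := ihy (2 * b) (r + b) ht.2
    simp only [weight, bound]
    push_cast
    linarith
  | trisect x y z ihx ihy ihz =>
    simp only [valid, Bool.and_eq_true] at ht
    have := ihx (3 * b) r ht.1.1
    have := ihy (3 * b) (r + b) ht.1.2
    have := ihz (3 * b) (r + 2 * b) ht.2
    simp only [weight, bound]
    push_cast
    linarith

/-- A covering system whose total weight is less than `1`. -/
def cover : CoverTree :=
  .trisect (.leaf [3]) (.bisect (.leaf [2, 3]) (.bisect (.bisect (.leaf [2, 2, 2, 3]) (.bisect
  (.leaf [2, 2, 2, 2, 3]) (.bisect (.leaf [2, 2, 2, 2, 2, 3]) (.trisect (.leaf [2, 2, 2, 3, 3,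
  2, 2]) (.trisect (.leaf [2, 2, 3, 3, 2, 2, 2, 3]) (.leaf [2, 2, 3, 3, 2, 2, 3, 2]) (.leaf [2,
  2, 3, 3, 3, 2, 2, 2])) (.trisect (.leaf [3, 3, 2, 3, 2, 2, 2, 2]) (.leaf [3, 3, 3, 2, 2, 2, 2,
  2]) (.bisect (.leaf [2, 2, 2, 2, 2, 2, 3, 3, 3]) (.bisect (.leaf [2, 2, 2, 2, 2, 2, 2, 3, 3,
  3]) (.trisect (.leaf [3, 3, 2, 3, 3, 2, 2, 2, 2, 2, 2]) (.leaf [3, 3, 3, 3, 2, 2, 2, 2, 2, 2,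
  2]) (.bisect (.leaf [2, 2, 2, 2, 2, 2, 2, 2, 3, 3, 3, 3]) (.bisect (.leaf [2, 2, 2, 2, 2, 2,
  2, 2, 2, 3, 3, 3, 3]) (.leaf [2, 2, 2, 2, 2, 2, 2, 2, 2, 3, 3, 3, 3]))))))))))) (.bisect
  (.bisect (.leaf [2, 2, 2, 2, 3]) (.bisect (.leaf [2, 2, 2, 2, 2, 3]) (.bisect (.leaf [2, 2, 2,
  2, 2, 2, 3]) (.trisect (.leaf [2, 2, 2, 2, 3, 3, 2, 2]) (.leaf [2, 2, 2, 3, 3, 2, 2, 2])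
  (.trisect (.leaf [2, 3, 3, 2, 3, 2, 2, 2, 2]) (.leaf [2, 3, 3, 3, 2, 2, 2, 2, 2]) (.bisect
  (.leaf [2, 2, 2, 2, 2, 2, 2, 3, 3, 3]) (.trisect (.leaf [2, 3, 3, 3, 3, 2, 2, 2, 2, 2, 2])
  (.leaf [3, 3, 3, 3, 2, 2, 2, 2, 2, 2, 2]) (.bisect (.leaf [2, 2, 2, 2, 2, 2, 2, 2, 3, 3, 3,
  3]) (.bisect (.leaf [2, 2, 2, 2, 2, 2, 2, 2, 2, 3, 3, 3, 3]) (.leaf [2, 2, 2, 2, 2, 2, 2, 2,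
  2, 3, 3, 3, 3])))))))))) (.trisect (.leaf [2, 3, 3, 2, 2]) (.trisect (.leaf [3, 3, 2, 2, 2,
  3]) (.leaf [3, 3, 2, 2, 3, 2]) (.trisect (.leaf [3, 3, 3, 2, 3, 2, 2]) (.leaf [3, 3, 3, 3, 2,
  2, 2]) (.trisect (.leaf [3, 3, 3, 2, 3, 3, 2, 2]) (.leaf [3, 3, 3, 3, 3, 2, 2, 2]) (.bisect
  (.leaf [3, 3, 2, 2, 2, 2, 3, 3, 3]) (.leaf [3, 3, 3, 2, 2, 2, 2, 3, 3]))))) (.bisect (.leaf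
  [2, 2, 2, 2, 3, 3]) (.bisect (.leaf [2, 2, 2, 2, 2, 3, 3]) (.trisect (.leaf [2, 3, 3, 3, 2, 2,
  2, 2]) (.leaf [3, 3, 3, 2, 2, 2, 2, 2]) (.bisect (.leaf [2, 2, 2, 2, 2, 2, 3, 3, 3]) (.bisect
  (.leaf [2, 2, 2, 2, 2, 2, 2, 3, 3, 3]) (.trisect (.leaf [2, 3, 3, 3, 3, 2, 2, 2, 2, 2, 2])
  (.leaf [3, 3, 3, 3, 2, 2, 2, 2, 2, 2, 2]) (.bisect (.leaf [2, 2, 2, 2, 2, 2, 2, 2, 3, 3, 3,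
  3]) (.bisect (.leaf [2, 2, 2, 2, 2, 2, 2, 2, 2, 3, 3, 3, 3]) (.leaf [2, 2, 2, 2, 2, 2, 2, 2,
  2, 3, 3, 3, 3]))))))))))))) (.bisect (.bisect (.leaf [2, 2, 3]) (.bisect (.bisect (.leaf [2,
  2, 2, 2, 3]) (.bisect (.leaf [2, 2, 2, 2, 2, 3]) (.bisect (.leaf [2, 2, 2, 2, 2, 2, 3])
  (.trisect (.leaf [2, 2, 2, 2, 3, 3, 2, 2]) (.leaf [2, 2, 2, 3, 3, 2, 2, 2]) (.trisect (.leaf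
  [2, 3, 3, 2, 3, 2, 2, 2, 2]) (.leaf [2, 3, 3, 3, 2, 2, 2, 2, 2]) (.bisect (.leaf [2, 2, 2, 2,
  2, 2, 2, 3, 3, 3]) (.bisect (.leaf [2, 2, 2, 2, 2, 2, 2, 2, 3, 3, 3]) (.bisect (.leaf [2, 2,
  2, 2, 2, 2, 2, 2, 2, 3, 3, 3]) (.leaf [2, 2, 2, 2, 2, 2, 2, 2, 2, 3, 3, 3]))))))))) (.bisect
  (.leaf [2, 2, 2, 2, 3]) (.trisect (.leaf [2, 2, 3, 3, 2, 2]) (.trisect (.leaf [2, 3, 3, 2, 2,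
  2, 3]) (.leaf [2, 3, 3, 2, 2, 3, 2]) (.leaf [2, 3, 3, 3, 2, 2, 2])) (.bisect (.leaf [2, 2, 2,
  2, 2, 3, 3]) (.bisect (.leaf [2, 2, 2, 2, 2, 2, 3, 3]) (.trisect (.leaf [2, 2, 3, 3, 3, 2, 2,
  2, 2]) (.leaf [2, 3, 3, 3, 2, 2, 2, 2, 2]) (.bisect (.leaf [2, 2, 2, 2, 2, 2, 2, 3, 3, 3])
  (.bisect (.leaf [2, 2, 2, 2, 2, 2, 2, 2, 3, 3, 3]) (.bisect (.leaf [2, 2, 2, 2, 2, 2, 2, 2, 2,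
  3, 3, 3]) (.bisect (.leaf [2, 2, 2, 2, 2, 2, 2, 2, 2, 2, 3, 3, 3]) (.leaf [2, 2, 2, 2, 2, 2,
  2, 2, 2, 2, 3, 3, 3])))))))))))) (.bisect (.bisect (.leaf [2, 2, 2, 3]) (.bisect (.leaf [2, 2,
  2, 2, 3]) (.bisect (.leaf [2, 2, 2, 2, 2, 3]) (.trisect (.leaf [2, 2, 2, 3, 3, 2, 2])
  (.trisect (.leaf [2, 2, 3, 3, 2, 2, 2, 3]) (.leaf [2, 2, 3, 3, 2, 2, 3, 2]) (.leaf [2, 2, 3,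
  3, 3, 2, 2, 2])) (.trisect (.leaf [3, 3, 2, 3, 2, 2, 2, 2]) (.leaf [3, 3, 3, 2, 2, 2, 2, 2])
  (.bisect (.leaf [2, 2, 2, 2, 2, 2, 3, 3, 3]) (.bisect (.leaf [2, 2, 2, 2, 2, 2, 2, 3, 3, 3])
  (.trisect (.leaf [3, 3, 2, 3, 3, 2, 2, 2, 2, 2, 2]) (.leaf [3, 3, 3, 3, 2, 2, 2, 2, 2, 2, 2])
  (.bisect (.leaf [2, 2, 2, 2, 2, 2, 2, 2, 3, 3, 3, 3]) (.bisect (.leaf [2, 2, 2, 2, 2, 2, 2, 2,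
  2, 3, 3, 3, 3]) (.leaf [2, 2, 2, 2, 2, 2, 2, 2, 2, 3, 3, 3, 3]))))))))))) (.bisect (.bisect
  (.leaf [2, 2, 2, 2, 3]) (.bisect (.leaf [2, 2, 2, 2, 2, 3]) (.bisect (.leaf [2, 2, 2, 2, 2, 2,
  3]) (.trisect (.leaf [2, 2, 2, 2, 3, 3, 2, 2]) (.leaf [2, 2, 2, 3, 3, 2, 2, 2]) (.trisect
  (.leaf [2, 3, 3, 2, 3, 2, 2, 2, 2]) (.leaf [2, 3, 3, 3, 2, 2, 2, 2, 2]) (.bisect (.leaf [2, 2,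
  2, 2, 2, 2, 2, 3, 3, 3]) (.trisect (.leaf [2, 3, 3, 3, 3, 2, 2, 2, 2, 2, 2]) (.leaf [3, 3, 3,
  3, 2, 2, 2, 2, 2, 2, 2]) (.bisect (.leaf [2, 2, 2, 2, 2, 2, 2, 2, 3, 3, 3, 3]) (.bisect (.leaf
  [2, 2, 2, 2, 2, 2, 2, 2, 2, 3, 3, 3, 3]) (.leaf [2, 2, 2, 2, 2, 2, 2, 2, 2, 3, 3, 3,
  3])))))))))) (.trisect (.leaf [2, 3, 3, 2, 2]) (.trisect (.leaf [3, 3, 2, 2, 2, 3]) (.leaf [3,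
  3, 2, 2, 3, 2]) (.trisect (.leaf [3, 3, 3, 2, 3, 2, 2]) (.leaf [3, 3, 3, 3, 2, 2, 2])
  (.trisect (.leaf [3, 3, 3, 2, 3, 3, 2, 2]) (.leaf [3, 3, 3, 3, 3, 2, 2, 2]) (.bisect (.leaf
  [3, 3, 2, 2, 2, 2, 3, 3, 3]) (.bisect (.leaf [2, 2, 2, 2, 2, 3, 3, 3, 3, 3]) (.bisect (.leaf
  [2, 2, 2, 2, 2, 2, 3, 3, 3, 3, 3]) (.leaf [3, 3, 3, 2, 2, 2, 2, 2, 2, 3, 3]))))))) (.bisect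
  (.leaf [2, 2, 2, 2, 3, 3]) (.bisect (.leaf [2, 2, 2, 2, 2, 3, 3]) (.trisect (.leaf [2, 3, 3,
  3, 2, 2, 2, 2]) (.trisect (.leaf [3, 3, 3, 2, 2, 2, 2, 2, 3]) (.leaf [3, 3, 3, 2, 2, 2, 2, 3,
  2]) (.leaf [3, 3, 3, 2, 2, 3, 2, 2, 2])) (.bisect (.leaf [2, 2, 2, 2, 2, 2, 3, 3, 3]) (.bisect
  (.leaf [2, 2, 2, 2, 2, 2, 2, 3, 3, 3]) (.trisect (.leaf [2, 3, 3, 3, 3, 2, 2, 2, 2, 2, 2])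
  (.leaf [3, 3, 3, 3, 2, 2, 2, 2, 2, 2, 2]) (.bisect (.leaf [2, 2, 2, 2, 2, 2, 2, 2, 3, 3, 3,
  3]) (.bisect (.leaf [2, 2, 2, 2, 2, 2, 2, 2, 2, 3, 3, 3, 3]) (.leaf [2, 2, 2, 2, 2, 2, 2, 2,
  2, 3, 3, 3, 3])))))))))))))

theorem cover_valid : cover.valid 1 = true := by decide +kernel

/-- At the exponent 1.23, dividing always by 2 or always by 3 gives totals of about 1.083 and 1.171.
Factors adapted to the residue bring the total below 1. -/
theorem cover_bound : cover.bound 1 0 < 10 ^ 9 := by decide +kernel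

theorem cover_weight_lt_one : cover.weight 1 0 < 1 := by
  refine (weight_le cover 1 0 cover_valid).trans_lt ?_
  rw [div_lt_one (by positivity)]
  exact_mod_cast cover_bound

end CoverTree

theorem exists_weightSum_le :
    ∃ C : ℝ, 0 ≤ C ∧ ∀ N : ℕ, weightSum N ≤ C * (N : ℝ) ^ (1.23 : ℝ) := by
  obtain ⟨B, hB⟩ := CoverTree.classSum_le .cover 1 0 CoverTree.cover_valid
  have hlt := CoverTree.cover_weight_lt_one
  set ρ := CoverTree.cover.weight 1 0
  -- This C solves max(B, 0) + ρC = C, and N^1.23 ≥ 1 absorbs the constant term.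
  refine ⟨max B 0 / (1 - ρ), div_nonneg (le_max_right _ _) (by linarith), fun N => ?_⟩
  induction N using Nat.strong_induction_on with
  | _ N ih =>
    rcases N.eq_zero_or_pos with rfl | hN
    · norm_num [weightSum]
    · have hC : 0 ≤ max B 0 / (1 - ρ) := div_nonneg (le_max_right _ _) (by linarith)
      have h := hB N _ hC hN ih
      rw [classSum_one] at h
      have h1 : (1 : ℝ) ≤ (N : ℝ) ^ (1.23 : ℝ) :=
        Real.one_le_rpow (by exact_mod_cast hN) (by norm_num)
      have h2 : max B 0 ≤ max B 0 * (N : ℝ) ^ (1.23 : ℝ) :=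
        le_mul_of_one_le_right (le_max_right _ _) h1
      have h3 : max B 0 * (N : ℝ) ^ (1.23 : ℝ) =
          (1 - ρ) * (max B 0 / (1 - ρ) * (N : ℝ) ^ (1.23 : ℝ)) := by
        have : (1 - ρ) ≠ 0 := by linarith
        field_simp
      linarith [le_max_left B 0]

/-! ### Asymptotic estimates -/

/-- The constant 3/2 exceeds 1/log 2. -/
theorem bitLen_le_log {v : ℕ} (hv : 1 ≤ v) : (bitLen v : ℝ) ≤ 1 + 3 / 2 * Real.log v := by
  have hsize : bitLen v = v.size := max_eq_right (Nat.size_pos.2 hv)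
  have h1 : 2 ^ (v.size - 1) ≤ v := Nat.lt_size.1 (by have := Nat.size_pos.2 hv; omega)
  have h2 : ((v.size - 1 : ℕ) : ℝ) * Real.log 2 ≤ Real.log v := by
    rw [← Real.log_pow]
    exact Real.log_le_log (by positivity) (by exact_mod_cast h1)
  have h3 : (v.size : ℝ) = ((v.size - 1 : ℕ) : ℝ) + 1 := by
    have := Nat.size_pos.2 hv
    exact_mod_cast (by omega : v.size = v.size - 1 + 1)
  rw [hsize, h3]
  have h4 := Real.log_two_gt_d9
  have h5 : (0 : ℝ) ≤ ((v.size - 1 : ℕ) : ℝ) := by positivity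
  nlinarith

namespace TimeImproved

theorem cell_pos {N : ℕ} (hN : 1 ≤ N) : 1 ≤ (limits N).cell :=
  Nat.size_pos.2 (by positivity)

theorem cell_le_log {N : ℕ} (hN : 1 ≤ N) : ((limits N).cell : ℝ) ≤ 5 * (1 + Real.log N) := by
  have h : (limits N).cell ≤ bitLen (N ^ 3) := le_max_right _ _
  have h1 := bitLen_le_log (v := N ^ 3) (Nat.one_le_pow _ _ hN)
  have h2 : ((limits N).cell : ℝ) ≤ bitLen (N ^ 3) := by exact_mod_cast h
  have h3 : 0 ≤ Real.log N := Real.log_natCast_nonneg N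
  push_cast at h1
  rw [Real.log_pow] at h1
  push_cast at h1
  linarith

theorem bitLen_val_le {N : ℕ} (hN : 3 ≤ N) :
    (bitLen (limits N).val : ℝ) ≤ 12 * Real.log N := by
  have h1 : 1 ≤ (limits N).val := (two_le_val N).trans' (by norm_num)
  have h2 : (limits N).val ≤ N ^ 7 := by
    have a1 : (N + 1) ^ 3 ≤ (2 * N) ^ 3 := Nat.pow_le_pow_left (by omega) 3
    have a2 : 3 ^ 4 ≤ N ^ 4 := Nat.pow_le_pow_left hN 4
    calc (limits N).val = 2 * (N + 1) ^ 3 := rfl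
      _ ≤ 3 ^ 4 * N ^ 3 := by nlinarith [Nat.zero_le (N ^ 3)]
      _ ≤ N ^ 4 * N ^ 3 := Nat.mul_le_mul_right _ a2
      _ = N ^ 7 := by ring
  have h3 := bitLen_le_log (v := N ^ 7) (Nat.one_le_pow _ _ (by omega))
  have h4 : (bitLen (limits N).val : ℝ) ≤ bitLen (N ^ 7) := by exact_mod_cast bitLen_mono h2
  have h5 : 1 ≤ Real.log N := by
    rw [Real.le_log_iff_exp_le (by exact_mod_cast (by omega : 0 < N))]
    have : (3 : ℝ) ≤ N := by exact_mod_cast hN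
    linarith [Real.exp_one_lt_d9]
  push_cast at h3
  rw [Real.log_pow] at h3
  push_cast at h3
  linarith

theorem bitLen_cell_le_val {N : ℕ} : bitLen (limits N).cell ≤ bitLen (limits N).val :=
  bitLen_mono (by have := two_mul_cell_le N; omega)

theorem bitLen_cell_le {N : ℕ} (hN : 1 ≤ N) (h1 : 1 ≤ Real.log N)
    (h2 : 1 ≤ Real.log (Real.log N)) :
    (bitLen (limits N).cell : ℝ) ≤ 7 * Real.log (Real.log N) := by
  have h3 := bitLen_le_log (cell_pos hN)
  have h4 := cell_le_log hN
  have h5 : (0 : ℝ) < (limits N).cell := by exact_mod_cast cell_pos hN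
  have h6 : Real.log (limits N).cell ≤ Real.log (10 * Real.log N) :=
    Real.log_le_log h5 (by linarith)
  rw [Real.log_mul (by norm_num) (by linarith)] at h6
  have h7 : Real.log 10 ≤ 3 := by
    rw [Real.log_le_iff_le_exp (by norm_num)]
    have := Real.exp_one_gt_d9
    calc (10 : ℝ) ≤ 2.7 ^ 3 := by norm_num
      _ ≤ Real.exp 1 ^ 3 := by gcongr; linarith
      _ = Real.exp 3 := by rw [← Real.exp_nat_mul]; norm_num
  linarith

theorem isBigO_width :
    (fun N : ℕ => ((limits N).width : ℝ)) =O[Filter.atTop] (fun N : ℕ => Real.log (N : ℝ)) := by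
  refine Asymptotics.IsBigO.of_bound 12 ?_
  filter_upwards [Filter.eventually_ge_atTop 3] with N hN
  have h : (limits N).width = bitLen (limits N).val := max_eq_left bitLen_cell_le_val
  rw [Real.norm_of_nonneg (by positivity), Real.norm_of_nonneg (Real.log_natCast_nonneg N), h]
  exact bitLen_val_le hN

theorem isBigO_space :
    (fun N : ℕ => ((limits N).space : ℝ))
      =O[Filter.atTop] (fun N : ℕ => (N : ℝ) * Real.log (Real.log (N : ℝ))) := by
  have hlog : Filter.Tendsto (fun N : ℕ => Real.log (N : ℝ)) Filter.atTop Filter.atTop :=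
    Real.tendsto_log_atTop.comp tendsto_natCast_atTop_atTop
  -- The 22 registers take at most 22 · 12 log N ≤ 264N bits, the array at most 14 N log log N.
  refine Asymptotics.IsBigO.of_bound 300 ?_
  filter_upwards [Filter.eventually_ge_atTop 3, hlog.eventually_ge_atTop 1,
    (Real.tendsto_log_atTop.comp hlog).eventually_ge_atTop 1] with N hN h1 h2
  have h2' : 1 ≤ Real.log (Real.log N) := h2
  have hN1 : (1 : ℝ) ≤ N := by exact_mod_cast (by omega : 1 ≤ N)
  have hval := bitLen_val_le hN
  have hcell := bitLen_cell_le (by omega) h1 h2'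
  have hle : Real.log N ≤ N := (Real.log_le_sub_one_of_pos (by linarith)).trans (by linarith)
  have hcard : Fintype.card Reg = 22 := by decide
  rw [Real.norm_of_nonneg (by positivity), Real.norm_of_nonneg (by positivity), Limits.space, hcard]
  have hlen : (limits N).len = N + 1 := rfl
  rw [hlen]
  push_cast
  have h3 : ((N : ℝ) + 1) * bitLen (limits N).cell ≤ (2 * N) * (7 * Real.log (Real.log N)) := by
    gcongr
    linarith
  have h4 : (N : ℝ) ≤ N * Real.log (Real.log N) := le_mul_of_one_le_right (by linarith) h2'
  nlinarith

theorem sum_roundCost_le {N : ℕ} (hN : 1 ≤ N) :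
    (∑ n ∈ Finset.Icc 2 N, ((roundCost N n : ℝ) + 1)) ≤
      244 * (N * (1 + Real.log N) ^ 2) + 18 * weightSum N := by
  have hL := cell_le_log hN
  set L : ℝ := ((limits N).cell : ℝ) with hLdef
  have hlog : 0 ≤ Real.log N := Real.log_natCast_nonneg N
  set y := 1 + Real.log (N : ℝ) with hy
  have hL0 : 0 ≤ L := by positivity
  -- With L ≤ 5y, the constant is 235 = 3 · 25 + 22 · 5 + 50.
  have hterm : ∀ n ∈ Finset.Icc 2 N, (roundCost N n : ℝ) + 1 ≤
      235 * y ^ 2 + 18 * complexityWeight (n - 1) + 9 * (N * ((n : ℝ))⁻¹) := by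
    intro n hn
    have hn2 : 2 ≤ n := (Finset.mem_Icc.1 hn).1
    have hn0 : (0 : ℝ) < n := by exact_mod_cast (by omega : 0 < n)
    have hn1 : (0 : ℝ) < (n - 1 : ℕ) := by exact_mod_cast (by omega : 0 < n - 1)
    have hle : ((n - 1 : ℕ) : ℝ) ≤ n := by exact_mod_cast Nat.sub_le n 1
    have h1 : ((N / n : ℕ) : ℝ) ≤ N * (n : ℝ)⁻¹ := by
      rw [← div_eq_mul_inv]; exact Nat.cast_div_le
    have hE : (maxVal (intComplexity (n - 1)) : ℝ) ≤
        (3 : ℝ) ^ ((intComplexity (n - 1) : ℝ) / 3) := by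
      refine le_of_pow_le_pow_left₀ (n := 3) (by norm_num) (by positivity) ?_
      rw [← Real.rpow_mul_natCast (by norm_num)]
      have := maxVal_pow_three_le (intComplexity (n - 1))
      rw [show (intComplexity (n - 1) : ℝ) / 3 * (3 : ℕ) = intComplexity (n - 1) by
        push_cast; ring, Real.rpow_natCast]
      exact_mod_cast this
    have h2 : ((2 * maxVal (intComplexity (n - 1)) / n : ℕ) : ℝ) ≤
        2 * complexityWeight (n - 1) := by
      calc ((2 * maxVal (intComplexity (n - 1)) / n : ℕ) : ℝ)
          ≤ ((2 * maxVal (intComplexity (n - 1)) : ℕ) : ℝ) / n := Nat.cast_div_le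
        _ ≤ (2 * (3 : ℝ) ^ ((intComplexity (n - 1) : ℝ) / 3)) / (n - 1 : ℕ) := by
            push_cast
            gcongr
        _ = 2 * complexityWeight (n - 1) := by rw [complexityWeight]; ring
    rw [roundCost]
    push_cast
    rw [← hLdef]
    have h3 : L ^ 2 ≤ 25 * y ^ 2 := by nlinarith
    have h4 : L ≤ 5 * y ^ 2 := by nlinarith
    have h5 : 1 ≤ y ^ 2 := by nlinarith
    linarith
  refine (Finset.sum_le_sum hterm).trans ?_
  rw [Finset.sum_add_distrib, Finset.sum_add_distrib, ← Finset.mul_sum, ← Finset.mul_sum,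
    ← Finset.mul_sum]
  have hN0 : (0 : ℝ) ≤ N := by positivity
  have s1 : ∑ _n ∈ Finset.Icc 2 N, y ^ 2 ≤ N * y ^ 2 := by
    rw [Finset.sum_const, nsmul_eq_mul]
    gcongr
    simp
  have s2 : ∑ n ∈ Finset.Icc 2 N, complexityWeight (n - 1) ≤ weightSum N := by
    rw [← Finset.sum_image (g := fun n => n - 1) (f := complexityWeight)]
    · refine Finset.sum_le_sum_of_subset_of_nonneg (fun m hm => ?_) fun n _ _ =>
        complexityWeight_nonneg n
      simp only [Finset.mem_image, Finset.mem_Icc] at hm ⊢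
      omega
    · intro a ha b hb hab
      simp only [Finset.coe_Icc, Set.mem_Icc] at ha hb
      have : a - 1 = b - 1 := hab
      omega
  have s3 : ∑ n ∈ Finset.Icc 2 N, ((n : ℝ))⁻¹ ≤ y := by
    have h := harmonic_le_one_add_log N
    rw [harmonic_eq_sum_Icc] at h
    push_cast at h
    refine le_trans ?_ h
    exact Finset.sum_le_sum_of_subset_of_nonneg (Finset.Icc_subset_Icc_left (by norm_num))
      fun _ _ _ => by positivity
  have s3' : ∑ n ∈ Finset.Icc 2 N, (N : ℝ) * ((n : ℝ))⁻¹ ≤ N * y ^ 2 := by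
    rw [← Finset.mul_sum]
    refine mul_le_mul_of_nonneg_left (s3.trans ?_) hN0
    nlinarith
  linarith

theorem isBigO_time :
    (fun N : ℕ => ((3 * (N ^ 3).size + 3 * N + 13 +
      ∑ n ∈ Finset.Icc 2 N, (roundCost N n + 1) : ℕ) : ℝ))
        =O[Filter.atTop] (fun N : ℕ => (N : ℝ) ^ (1.230175 : ℝ)) := by
  obtain ⟨C, hC, hsum⟩ := exists_weightSum_le
  -- 275 = 244 + 15 + 3 + 13 collects the multiples of N y², and y ≤ 11 N^0.1 gives N y² ≤ 121
  -- N^1.2.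
  refine Asymptotics.IsBigO.of_bound (275 * 121 + 18 * C) ?_
  filter_upwards [Filter.eventually_ge_atTop 1] with N hN
  have hN1 : (1 : ℝ) ≤ N := by exact_mod_cast hN
  have hN0 : (0 : ℝ) < N := by linarith
  rw [Real.norm_of_nonneg (by positivity), Real.norm_of_nonneg (by positivity)]
  have h1 := sum_roundCost_le hN
  have h2 : ((N ^ 3).size : ℝ) ≤ 5 * (1 + Real.log N) := cell_le_log hN
  have hlog : 0 ≤ Real.log N := Real.log_natCast_nonneg N
  set y := 1 + Real.log (N : ℝ) with hy
  have hy1 : 1 ≤ y := by linarith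
  have h3 : y ≤ 11 * (N : ℝ) ^ (0.1 : ℝ) := by
    have a1 := Real.log_le_rpow_div hN0.le (show (0 : ℝ) < 0.1 by norm_num)
    have a2 : (1 : ℝ) ≤ (N : ℝ) ^ (0.1 : ℝ) := Real.one_le_rpow hN1 (by norm_num)
    have a3 : (N : ℝ) ^ (0.1 : ℝ) / 0.1 = 10 * (N : ℝ) ^ (0.1 : ℝ) := by ring
    linarith
  have h4 : N * y ^ 2 ≤ 121 * (N : ℝ) ^ (1.230175 : ℝ) := by
    calc (N : ℝ) * y ^ 2 ≤ N * (11 * (N : ℝ) ^ (0.1 : ℝ)) ^ 2 := by gcongr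
      _ = 121 * (N : ℝ) ^ (1.2 : ℝ) := by
          rw [mul_pow, ← Real.rpow_mul_natCast hN0.le, mul_left_comm,
            ← Real.rpow_one_add' hN0.le (by norm_num)]
          norm_num
      _ ≤ 121 * (N : ℝ) ^ (1.230175 : ℝ) := by
          gcongr
          norm_num
  have h5 : weightSum N ≤ C * (N : ℝ) ^ (1.230175 : ℝ) := by
    refine (hsum N).trans (mul_le_mul_of_nonneg_left ?_ hC)
    exact Real.rpow_le_rpow_of_exponent_le hN1 (by norm_num)
  have h6 : 1 ≤ y ^ 2 := by nlinarith
  have h7 : (N : ℝ) ≤ N * y ^ 2 := le_mul_of_one_le_right hN0.le h6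
  have h8 : y ≤ N * y ^ 2 := by nlinarith
  push_cast
  linarith

end TimeImproved

theorem mainTheorem1 :
    ∃ (output : ℕ → Mem) (usage : ℕ → Usage),
      (∀ N : ℕ, 1 ≤ N →
        Exec TimeImproved.program (TimeImproved.input N) (output N) (usage N) ∧
        ∀ n : ℕ, 1 ≤ n → n ≤ N → (output N).arr[n]? = some (intComplexity n)) ∧
      (fun N : ℕ => ((usage N).time : ℝ))
        =O[Filter.atTop] (fun N : ℕ => (N : ℝ) ^ (1.230175 : ℝ)) ∧
      (fun N : ℕ => ((usage N).space : ℝ))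
        =O[Filter.atTop] (fun N : ℕ => (N : ℝ) * Real.log (Real.log (N : ℝ))) ∧
      (fun N : ℕ => ((usage N).width : ℝ))
        =O[Filter.atTop] (fun N : ℕ => Real.log (N : ℝ)) := by
  -- The condition 1 ≤ N stands inside the existential so that `choose` yields functions on all of
  -- ℕ, with dummy values at 0.
  have hrun : ∀ N : ℕ, ∃ τ ρ, 1 ≤ N →
      Exec TimeImproved.program (TimeImproved.input N) τ ρ ∧
      ρ.time ≤ 3 * (N ^ 3).size + 3 * N + 13 +
        ∑ n ∈ Finset.Icc 2 N, (TimeImproved.roundCost N n + 1) ∧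
      ρ.space ≤ (TimeImproved.limits N).space ∧ ρ.width ≤ (TimeImproved.limits N).width ∧
      ∀ n, 1 ≤ n → n ≤ N → τ.arr[n]? = some (intComplexity n) := by
    intro N
    by_cases hN : 1 ≤ N
    · obtain ⟨τ, ρ, he, ht, hs, hw, -, hq⟩ := TimeImproved.runs_program hN
      exact ⟨τ, ρ, fun _ => ⟨he, ht, hs, hw, hq⟩⟩
    · exact ⟨TimeImproved.input N, ⟨0, 0, 0⟩, fun h => absurd h hN⟩
  choose output usage h using hrun
  have key : ∀ (u v : ℕ → ℕ) (g : ℕ → ℝ), (∀ N, 1 ≤ N → u N ≤ v N) →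
      (fun N => (v N : ℝ)) =O[Filter.atTop] g → (fun N => (u N : ℝ)) =O[Filter.atTop] g := by
    intro u v g huv hv
    refine Asymptotics.IsBigO.trans (.of_bound 1 ?_) hv
    filter_upwards [Filter.eventually_ge_atTop 1] with N hN
    simpa using huv N hN
  refine ⟨output, usage, fun N hN => ⟨(h N hN).1, (h N hN).2.2.2.2⟩, ?_, ?_, ?_⟩
  · exact key _ _ _ (fun N hN => (h N hN).2.1) TimeImproved.isBigO_time
  · exact key _ _ _ (fun N hN => (h N hN).2.2.1) TimeImproved.isBigO_space
  · exact key _ _ _ (fun N hN => (h N hN).2.2.2.1) TimeImproved.isBigO_width
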